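/- Fix $p\in(0,1)$. Let $(\sigma^{(n),p})_{n\ge1}$ be the Markov chain, on any probability space, such that $\sigma^{(1),p}$ is the unique permutation of $1$ and, given $\sigma^{(n),p}$ (a permutation of $n$), the permutation $\sigma^{(n+1),p}$ of $n+1$ is obtained as follows: choose $j$ uniformly at random in $\{1,\dots,n\}$; in the one-line notation of $\sigma^{(n),p}$ increase all values bigger than $j$ by $1$; and replace $j$ by $j,\,j+1$ with probability $p$, and by $j+1,\,j$ with probability $1-p$. A permuton is a probability measure on $[0,1]^2$ whose two marginals are the Lebesgue measure $\mathrm{Leb}$ on $[0,1]$. The permuton of a permutation $\pi$ of $n$ is $\mu_\pi=\frac1n\sum_{i=1}^n\lambda(i,\pi(i))$, where $\lambda(i,j)$ is the uniform probability measure on $[\frac{i-1}n,\frac in]\times[\frac{j-1}n,\frac jn]$. Permutations $\pi^{(n)}$ converge to a permuton $\mu$ if $\mu_{\pi^{(n)}}\to\mu$ weakly. Let $(U_j)_{j\ge1}$ be i.i.d. uniform in $[0,1]$ and $(S_j)_{j\ge1}$ i.i.d. signs in $\{+1,-1\}$ with $\mathbb P(S_j=+1)=p$, the two sequences being independent of each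 other, on any probability space. For $x,y\in[0,1]$ let $i_{x,y}=\inf\{j\ge1: U_j\in(\min(x,y),\max(x,y)]\}$, and write $x\prec y$ if $i_{x,y}<\infty$ and $(y-x)\,S_{i_{x,y}}>0$. Put $\phi(x)=\mathrm{Leb}\{y\in[0,1]: y\prec x\}$, and let $\mu^{\mathrm{rec}}_p$ be the push-forward of $\mathrm{Leb}$ by $x\mapsto(x,\phi(x))$. **Theorem.** 1. Almost surely, $\prec$ is a (strict) total order on $[0,1]$, $\phi$ preserves $\mathrm{Leb}$, and $\mu^{\mathrm{rec}}_p$ is a permuton. 2. There is a random permuton $\mu$, defined on the probability space of $(\sigma^{(n),p})_{n\ge1}$, such that $\sigma^{(n),p}\to\mu$ almost surely as $n\to\infty$; and $\mu$ has the same distribution as $\mu^{\mathrm{rec}}_p$. 3. On the probability space of $(U_j)_{j\ge1}$ and $(S_j)_{j\ge1}$ there is a realization of the process $(\sigma^{(n),p})_{n\ge1}$ that converges almost surely to $\mu^{\mathrm{rec}}_p$ itself. -/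

import Mathlib

open MeasureTheory ProbabilityTheory Filter Topology
open scoped unitInterval ENNReal

noncomputable section

namespace RecSep

/-! ### Inflations and the random recursive separable permutations -/

/-- The inflation of a permutation `π` of size `n` at the value `j`, of type `s`
(`true` for increasing, `false` for decreasing): in one-line notation, every value bigger than `j`
is increased by one, and `j` is replaced by `j, j + 1` if `s = true` and by `j + 1, j` if
`s = false`.  With `k = π⁻¹ j` the position of `j`, this amounts to inserting a new point at the
position just after `k`, whose value is `j + 1` if `s = true` and `j` if `s = false`; the old
positions `> k` move up by one, and so do the old values that are at least the new one
(`finSuccEquiv' a` removes the point `a` from `Fin (n + 1)` and relabels the others in order). -/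
def inflate {n : ℕ} (π : Equiv.Perm (Fin n)) (j : Fin n) (s : Bool) : Equiv.Perm (Fin (n + 1)) :=
  (finSuccEquiv' (π.symm j).succ).trans
    ((Equiv.optionCongr π).trans (finSuccEquiv' (if s then j.succ else j.castSucc)).symm)

/-- The one-step transition probabilities of the model, from permutations of size `n` to
permutations of size `n + 1`: choose `j` uniformly among the `n` values, then inflate at `j`,
increasingly with probability `p` and decreasingly with probability `1 - p`. -/
def stepProb (p : ℝ) {n : ℕ} (π : Equiv.Perm (Fin n)) (τ : Equiv.Perm (Fin (n + 1))) : ℝ :=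
  ∑ j : Fin n, (1 / (n : ℝ)) *
    ((if inflate π j true = τ then p else 0) + (if inflate π j false = τ then 1 - p else 0))

/-- `perm` is a realization, on the probability space `(Ω, P)`, of the process of random recursive
separable permutations with parameter `p`: a Markov chain with transition probabilities
`stepProb p`.  Here `perm n` has size `n + 1`; the starting point is necessarily the only permutation
of size `1`. -/
structure IsRecursiveSeparable {Ω : Type*} [MeasurableSpace Ω] (p : ℝ) (P : Measure Ω)
    (perm : (n : ℕ) → Ω → Equiv.Perm (Fin (n + 1))) : Prop where
  measurable : ∀ (n : ℕ) (τ : Equiv.Perm (Fin (n + 1))), MeasurableSet (perm n ⁻¹' {τ})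
  step : ∀ (n : ℕ) (π : (k : ℕ) → Equiv.Perm (Fin (k + 1))),
    P.real {ω | ∀ k ≤ n + 1, perm k ω = π k} =
      P.real {ω | ∀ k ≤ n, perm k ω = π k} * stepProb p (π n) (π (n + 1))

/-! ### Permutons -/

/-- A permuton: a probability measure on the unit square both of whose marginals are the Lebesgue
measure on `[0, 1]`. -/
def IsPermuton (μ : ProbabilityMeasure (I × I)) : Prop :=
  (μ : Measure (I × I)).map Prod.fst = volume ∧ (μ : Measure (I × I)).map Prod.snd = volume

/-- The square in row `j` and column `i` (counted from `0`) of the `n × n` grid on the unit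
square. -/
def cell (n : ℕ) (i j : Fin n) : Set (I × I) :=
  {z | (z.1 : ℝ) ∈ Set.Icc ((i : ℝ) / n) (((i : ℝ) + 1) / n) ∧
    (z.2 : ℝ) ∈ Set.Icc ((j : ℝ) / n) (((j : ℝ) + 1) / n)}

theorem volume_cell_ne_zero {n : ℕ} (i j : Fin n) :
    (volume : Measure (I × I)) (cell n i j) ≠ 0 := by
  have hn : (0 : ℝ) < n := by exact_mod_cast i.pos
  have h0 : ∀ k : Fin n, (k : ℝ) / n ∈ I := fun k =>
    ⟨by positivity, (div_le_one hn).2 (by exact_mod_cast k.isLt.le)⟩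
  have h1 : ∀ k : Fin n, ((k : ℝ) + 1) / n ∈ I := fun k =>
    ⟨by positivity, (div_le_one hn).2 (by exact_mod_cast k.isLt)⟩
  have hc : cell n i j = Set.Icc (⟨_, h0 i⟩ : I) ⟨_, h1 i⟩ ×ˢ Set.Icc (⟨_, h0 j⟩ : I) ⟨_, h1 j⟩ := by
    ext z
    rfl
  rw [hc, Measure.volume_eq_prod, Measure.prod_prod, unitInterval.volume_Icc,
    unitInterval.volume_Icc]
  have hp : ∀ k : Fin n, 0 < ((k : ℝ) + 1) / n - (k : ℝ) / n := fun k => by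
    rw [← sub_div]
    simpa using hn
  exact mul_ne_zero (ENNReal.ofReal_pos.2 (hp i)).ne' (ENNReal.ofReal_pos.2 (hp j)).ne'

/-- The permuton of a permutation `π` of size `n + 1`, as a measure: the average over `i` of the
uniform probability measures on the squares in column `i` and row `π i`. -/
def permMeasure {n : ℕ} (π : Equiv.Perm (Fin (n + 1))) : Measure (I × I) :=
  ((n : ℝ≥0∞) + 1)⁻¹ • ∑ i : Fin (n + 1), volume[|cell (n + 1) i (π i)]

theorem isProbabilityMeasure_permMeasure {n : ℕ} (π : Equiv.Perm (Fin (n + 1))) :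
    IsProbabilityMeasure (permMeasure π) := by
  constructor
  have h : ∀ i : Fin (n + 1), (volume[|cell (n + 1) i (π i)] : Measure (I × I)) Set.univ = 1 :=
    fun i => (cond_isProbabilityMeasure (volume_cell_ne_zero i (π i))).measure_univ
  simp only [permMeasure, Measure.smul_apply, Measure.finsetSum_apply, h, smul_eq_mul]
  simp only [Finset.sum_const, Finset.card_univ, Fintype.card_fin, nsmul_eq_mul, mul_one]
  push_cast
  exact ENNReal.inv_mul_cancel (by simp) (by simp)

/-- The permuton of a permutation of size `n + 1`. -/
def permPermuton {n : ℕ} (π : Equiv.Perm (Fin (n + 1))) : ProbabilityMeasure (I × I) :=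
  ⟨permMeasure π, isProbabilityMeasure_permMeasure π⟩

/-! ### The recursive separable permuton -/

/-- `U` is a sequence of i.i.d. uniform random variables in `[0, 1]`, `S` is a sequence of i.i.d.
random signs which are positive (`true`) with probability `p`, and the two sequences are
independent.  Both are indexed from `0`. -/
structure IsUniformSigned {Ω : Type*} [MeasurableSpace Ω] (p : ℝ) (P : Measure Ω)
    (U : ℕ → Ω → I) (S : ℕ → Ω → Bool) : Prop where
  measurable_U : ∀ j, Measurable (U j)
  measurable_S : ∀ j, Measurable (S j)
  uniform_U : ∀ j, P.map (U j) = volume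
  sign_S : ∀ j, P.real {ω | S j ω = true} = p
  indep_U : iIndepFun U P
  indep_S : iIndepFun S P
  indep : IndepFun (fun ω j => U j ω) (fun ω j => S j ω) P

/-- `j` is the smallest index with `u j ∈ (min x y, max x y]`. -/
def IsFirstIndex (u : ℕ → I) (x y : I) (j : ℕ) : Prop :=
  u j ∈ Set.Ioc (min x y) (max x y) ∧ ∀ i < j, u i ∉ Set.Ioc (min x y) (max x y)

/-- The relation `x ≺ y` on `[0, 1]` defined by points `u j` and signs `s j`: if `j` is the smallest
index of a point in `(min x y, max x y]`, then `≺` agrees with `<` on `{x, y}` when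
`s j = true`, and with `>` when `s j = false`; if there is no such `j`, then `x` and `y` are
not related. -/
def prec (u : ℕ → I) (s : ℕ → Bool) (x y : I) : Prop :=
  ∃ j, IsFirstIndex u x y j ∧ ((s j = true ∧ x < y) ∨ (s j = false ∧ y < x))

/-- `φ(x)` is the Lebesgue measure of `{y ∈ [0, 1] : y ≺ x}`. -/
def phi (u : ℕ → I) (s : ℕ → Bool) (x : I) : I :=
  ⟨(volume : Measure I).real {y | prec u s y x}, measureReal_nonneg, measureReal_le_one⟩

theorem measurableSet_prec (u : ℕ → I) (s : ℕ → Bool) :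
    MeasurableSet {z : I × I | prec u s z.2 z.1} := by
  have h : ∀ i, MeasurableSet {z : I × I | u i ∈ Set.Ioc (min z.2 z.1) (max z.2 z.1)} := fun i => by
    have hmin : Measurable fun z : I × I => min z.2 z.1 := measurable_snd.min measurable_fst
    have hmax : Measurable fun z : I × I => max z.2 z.1 := measurable_snd.max measurable_fst
    have h1 : MeasurableSet {z : I × I | min z.2 z.1 < u i} := measurableSet_lt hmin measurable_const
    have h2 : MeasurableSet {z : I × I | u i ≤ max z.2 z.1} := measurableSet_le measurable_const hmax
    exact h1.inter h2
  have hlt : MeasurableSet {z : I × I | z.2 < z.1} := measurableSet_lt measurable_snd measurable_fst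
  have hgt : MeasurableSet {z : I × I | z.1 < z.2} := measurableSet_lt measurable_fst measurable_snd
  have hs : {z : I × I | prec u s z.2 z.1} =
      ⋃ j, ({z : I × I | u j ∈ Set.Ioc (min z.2 z.1) (max z.2 z.1)} ∩
        ⋂ i, ⋂ _ : i < j, {z : I × I | u i ∈ Set.Ioc (min z.2 z.1) (max z.2 z.1)}ᶜ) ∩
        (({_z : I × I | s j = true} ∩ {z : I × I | z.2 < z.1}) ∪
          ({_z : I × I | s j = false} ∩ {z : I × I | z.1 < z.2})) := by
    ext z
    simp [prec, IsFirstIndex]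
  rw [hs]
  exact MeasurableSet.iUnion fun j =>
    ((h j).inter (MeasurableSet.iInter fun i => MeasurableSet.iInter fun _ => (h i).compl)).inter
      (((MeasurableSet.const _).inter hlt).union ((MeasurableSet.const _).inter hgt))

theorem measurable_phi (u : ℕ → I) (s : ℕ → Bool) : Measurable (phi u s) := by
  refine Measurable.subtype_mk ?_
  exact (measurable_measure_prodMk_left (measurableSet_prec u s)).ennreal_toReal

/-- The measure defined by points `u j` and signs `s j`: the push-forward of the Lebesgue measure
on `[0, 1]` by `x ↦ (x, φ(x))`. -/
def muRec (u : ℕ → I) (s : ℕ → Bool) : ProbabilityMeasure (I × I) :=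
  ⟨(volume : Measure I).map fun x => (x, phi u s x),
    Measure.isProbabilityMeasure_map (measurable_id.prodMk (measurable_phi u s)).aemeasurable⟩

end RecSep

end

/-! The first `n` points cut the unit interval into `n + 1` gaps. A new point splits one gap into
two neighbours, and its sign says which of the two comes first for `≺`, while their order relative
to all other gaps is inherited. This is exactly an inflation. Hence the gaps, listed from left to
right and ranked by `≺`, form a permutation `gapPerm`, and its order is `≺` truncated to the first
`n` points (`gapPerm_lt_iff`). The gap hit by the next point is its rank among the earlier points.
For i.i.d. uniform points these ranks are independent and uniform, and they are independent of the
signs, so `gapPerm` is a realization of the chain (`IsUniformSigned.isRecursiveSeparable`).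

Convergence is deterministic once the points are equidistributed, which holds almost surely by the
strong law of large numbers. The normalized rank of the gap of `x` is the proportion of left end
points `y` with `y ≺ x`. Up to the gap of `x` at a fixed level `m`, this is an empirical average of
a function of finitely many gaps, and `φ(x)` is the corresponding integral up to the same error. The
gaps shrink, so ranks converge to `φ` uniformly (`Equidistributed.eventually_rank_sub_phi_le`), and
`permPermuton (gapPerm u s n)` tends to `muRec u s` (`Equidistributed.tendsto_gapPerm`). Marginals
pass to weak limits, so the limit is a permuton, and its second marginal says that `φ` preserves
Lebesgue measure.

For an arbitrary realization of the chain, the transition probabilities determine the law of the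
whole path (`IsRecursiveSeparable.map_eq`). Almost sure convergence and the law of the limit depend
on this law only, so both transfer from `gapPerm`. -/

noncomputable section

namespace RecSep

/-! ### Gaps between the first points, and the permutation of the gaps -/

/-- The index of the gap between the points `u 0, …, u (n - 1)` that contains `x`. -/
def gapIndex (u : ℕ → I) (n : ℕ) (x : I) : Fin (n + 1) :=
  ⟨((Finset.range n).filter fun j => u j ≤ x).card, by
    have := Finset.card_filter_le (Finset.range n) fun j => u j ≤ x
    rw [Finset.card_range] at this
    omega⟩

theorem gapIndex_val (u : ℕ → I) (n : ℕ) (x : I) :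
    (gapIndex u n x : ℕ) = ((Finset.range n).filter fun j => u j ≤ x).card := rfl

theorem gapIndex_mono (u : ℕ → I) (n : ℕ) : Monotone (gapIndex u n) := fun x y h => by
  rw [Fin.le_def, gapIndex_val, gapIndex_val]
  refine Finset.card_le_card fun j hj => ?_
  simp only [Finset.mem_filter] at hj ⊢
  exact ⟨hj.1, hj.2.trans h⟩

theorem gapIndex_lt_of_mem {u : ℕ → I} {n j : ℕ} {x y : I} (hj : j < n)
    (h : u j ∈ Set.Ioc x y) : gapIndex u n x < gapIndex u n y := by
  rw [Fin.lt_def, gapIndex_val, gapIndex_val]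
  refine Finset.card_lt_card ((Finset.ssubset_iff_of_subset fun i hi => ?_).2 ⟨j, ?_, ?_⟩)
  · simp only [Finset.mem_filter] at hi ⊢
    exact ⟨hi.1, hi.2.trans (h.1.trans_le h.2).le⟩
  · simpa using ⟨hj, h.2⟩
  · simpa using fun _ => h.1

theorem exists_mem_of_gapIndex_lt {u : ℕ → I} {n : ℕ} {x y : I}
    (h : gapIndex u n x < gapIndex u n y) : ∃ j < n, u j ∈ Set.Ioc x y := by
  by_contra! H
  refine h.not_ge ?_
  rw [Fin.le_def, gapIndex_val, gapIndex_val]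
  refine Finset.card_le_card fun i hi => ?_
  simp only [Finset.mem_filter, Finset.mem_range] at hi ⊢
  exact ⟨hi.1, not_lt.1 fun hx => H i hi.1 ⟨hx, hi.2⟩⟩

/-- Counting with `≤` puts each point into the gap on its right, which matches the half-open
intervals in the definition of `≺`. -/
theorem gapIndex_ne_iff {u : ℕ → I} {n : ℕ} {x y : I} :
    gapIndex u n x ≠ gapIndex u n y ↔ ∃ j < n, u j ∈ Set.Ioc (min x y) (max x y) := by
  rcases le_total x y with h | h
  · rw [min_eq_left h, max_eq_right h, ← (gapIndex_mono u n h).lt_iff_ne]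
    exact ⟨exists_mem_of_gapIndex_lt, fun ⟨j, hj, hm⟩ => gapIndex_lt_of_mem hj hm⟩
  · rw [min_eq_right h, max_eq_left h, ne_comm,
      ← (gapIndex_mono u n h).lt_iff_ne]
    exact ⟨exists_mem_of_gapIndex_lt, fun ⟨j, hj, hm⟩ => gapIndex_lt_of_mem hj hm⟩

theorem gapIndex_succ (u : ℕ → I) (n : ℕ) (x : I) :
    gapIndex u (n + 1) x =
      if u n ≤ x then (gapIndex u n x).succ else (gapIndex u n x).castSucc := by
  ext
  simp only [gapIndex, Finset.range_add_one, Finset.filter_insert]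
  split_ifs <;> simp

/-- The gap `k` of the new point splits into `k` (left half) and `k + 1` (right half). Only the
right half is a new position; all other gaps are relabelled by skipping it, as `inflate` does with
positions. -/
theorem gapIndex_succ_eq_succAbove (u : ℕ → I) (n : ℕ) (x : I) :
    gapIndex u (n + 1) x = if gapIndex u n x = gapIndex u n (u n) ∧ u n ≤ x then
      (gapIndex u n (u n)).succ else (gapIndex u n (u n)).succ.succAbove (gapIndex u n x) := by
  rw [gapIndex_succ]
  split_ifs with h1 h2 h2
  · rw [h2.1]
  · have h3 : gapIndex u n (u n) < gapIndex u n x :=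
      lt_of_le_of_ne (gapIndex_mono u n h1) fun h => h2 ⟨h.symm, h1⟩
    rw [Fin.succAbove_of_le_castSucc _ _ (by simpa [Fin.le_def, Nat.succ_le_iff] using h3)]
  · exact absurd h2.2 h1
  · have h3 := gapIndex_mono u n (not_le.1 h1).le
    rw [Fin.succAbove_of_castSucc_lt _ _ (by simpa [Fin.lt_def, Nat.lt_succ_iff] using h3)]

/-! ### Order comparisons in an inflated permutation. -/

theorem inflate_apply_succ {n : ℕ} (π : Equiv.Perm (Fin n)) (k : Fin n) (b : Bool) :
    inflate π (π k) b k.succ = if b then (π k).succ else (π k).castSucc := by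
  simp [inflate]

theorem inflate_apply_succAbove {n : ℕ} (π : Equiv.Perm (Fin n)) (k : Fin n) (b : Bool)
    (i : Fin n) : inflate π (π k) b (k.succ.succAbove i) =
      (if b then (π k).succ else (π k).castSucc).succAbove (π i) := by
  simp [inflate]

/-- The inserted value is adjacent to the old value `a`, so every other value compares with it as
with `a`, whatever the sign. -/
theorem pivot_lt_succAbove_iff {n : ℕ} {a b : Fin n} (h : b ≠ a) (t : Bool) :
    (if t then a.succ else a.castSucc) < (if t then a.succ else a.castSucc).succAbove b ↔
      a < b := by
  have h' : (b : ℕ) ≠ a := Fin.val_ne_of_ne h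
  rw [Fin.lt_succAbove_iff_le_castSucc, Fin.le_def, Fin.lt_def]
  cases t
  · simp
    omega
  · simp

theorem succAbove_lt_pivot_iff {n : ℕ} {a b : Fin n} (h : b ≠ a) (t : Bool) :
    (if t then a.succ else a.castSucc).succAbove b < (if t then a.succ else a.castSucc) ↔
      b < a := by
  have h' : (b : ℕ) ≠ a := Fin.val_ne_of_ne h
  rw [Fin.succAbove_lt_iff_castSucc_lt, Fin.lt_def, Fin.lt_def]
  cases t
  · simp
  · simp
    omega

/-- The relation `prec` decided by the first `n` points only. -/
def precBefore (u : ℕ → I) (s : ℕ → Bool) (n : ℕ) (x y : I) : Prop :=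
  ∃ j < n, IsFirstIndex u x y j ∧ ((s j = true ∧ x < y) ∨ (s j = false ∧ y < x))

theorem precBefore_mono {u : ℕ → I} {s : ℕ → Bool} {m n : ℕ} (h : m ≤ n) {x y : I} :
    precBefore u s m x y → precBefore u s n x y :=
  fun ⟨j, hj, H⟩ => ⟨j, hj.trans_le h, H⟩

theorem precBefore.prec {u : ℕ → I} {s : ℕ → Bool} {n : ℕ} {x y : I}
    (h : precBefore u s n x y) : prec u s x y :=
  let ⟨j, _, H⟩ := h
  ⟨j, H⟩

theorem prec.exists_precBefore {u : ℕ → I} {s : ℕ → Bool} {x y : I} (h : prec u s x y) :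
    ∃ n, precBefore u s n x y :=
  let ⟨j, H⟩ := h
  ⟨j + 1, j, j.lt_succ_self, H⟩

/-- Once `x` and `y` are separated by one of the first `n` points, later points do not matter. -/
theorem prec.precBefore {u : ℕ → I} {s : ℕ → Bool} {n : ℕ} {x y : I} (h : prec u s x y)
    (hne : gapIndex u n x ≠ gapIndex u n y) : precBefore u s n x y := by
  obtain ⟨j, hj, H⟩ := h
  obtain ⟨i, hi, hm⟩ := gapIndex_ne_iff.1 hne
  exact ⟨j, lt_of_le_of_lt (not_lt.1 fun hij => hj.2 i hij hm) hi, hj, H⟩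

theorem precBefore.gapIndex_ne {u : ℕ → I} {s : ℕ → Bool} {n : ℕ} {x y : I}
    (h : precBefore u s n x y) : gapIndex u n x ≠ gapIndex u n y :=
  let ⟨j, hj, H, _⟩ := h
  gapIndex_ne_iff.2 ⟨j, hj, H.1⟩

theorem precBefore_succ_of_gapIndex_eq {u : ℕ → I} {s : ℕ → Bool} {n : ℕ} {x y : I}
    (h : gapIndex u n x = gapIndex u n y) : precBefore u s (n + 1) x y ↔
      (u n ∈ Set.Ioc x y ∧ s n = true) ∨ (u n ∈ Set.Ioc y x ∧ s n = false) := by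
  have H : ∀ j < n, u j ∉ Set.Ioc (min x y) (max x y) := fun j hj hm =>
    gapIndex_ne_iff.2 ⟨j, hj, hm⟩ h
  constructor
  · rintro ⟨j, hj, hf, hs⟩
    obtain rfl : j = n := by
      by_contra hne
      exact H j (by omega) hf.1
    rcases hs with ⟨hs, hxy⟩ | ⟨hs, hxy⟩
    · left
      simpa [min_eq_left hxy.le, max_eq_right hxy.le, hs] using hf.1
    · right
      simpa [min_eq_right hxy.le, max_eq_left hxy.le, hs] using hf.1
  · rintro (⟨hm, hs⟩ | ⟨hm, hs⟩)
    · have hxy := hm.1.trans_le hm.2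
      refine ⟨n, n.lt_succ_self, ⟨?_, H⟩, Or.inl ⟨hs, hxy⟩⟩
      simpa [min_eq_left hxy.le, max_eq_right hxy.le] using hm
    · have hxy := hm.1.trans_le hm.2
      refine ⟨n, n.lt_succ_self, ⟨?_, H⟩, Or.inr ⟨hs, hxy⟩⟩
      simpa [min_eq_right hxy.le, max_eq_left hxy.le] using hm

theorem precBefore_succ_of_gapIndex_ne {u : ℕ → I} {s : ℕ → Bool} {n : ℕ} {x y : I}
    (h : gapIndex u n x ≠ gapIndex u n y) :
    precBefore u s (n + 1) x y ↔ precBefore u s n x y :=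
  ⟨fun H => H.prec.precBefore h, precBefore_mono n.le_succ⟩

/-- The permutation obtained by successive inflations at the gaps with indices `r 0, r 1, …`. -/
def inflations (r : (n : ℕ) → Fin (n + 1)) (s : ℕ → Bool) : (n : ℕ) → Equiv.Perm (Fin (n + 1))
  | 0 => 1
  | n + 1 => inflate (inflations r s n) (inflations r s n (r n)) (s n)

/-- The permutation of the gaps between the first `n` points: in the inflation by the `n`-th point,
the inflated position is the gap that contains this point. -/
def gapPerm (u : ℕ → I) (s : ℕ → Bool) : (n : ℕ) → Equiv.Perm (Fin (n + 1)) :=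
  inflations (fun n => gapIndex u n (u n)) s

/-- By induction: an inflation keeps the order of gaps already separated, and a pair first separated
by the new point is ordered by the new sign. The cases record which of `x`, `y` lie in the new right
half. -/
theorem gapPerm_lt_iff (u : ℕ → I) (s : ℕ → Bool) (n : ℕ) (x y : I) :
    gapPerm u s n (gapIndex u n x) < gapPerm u s n (gapIndex u n y) ↔ precBefore u s n x y := by
  induction n generalizing x y with
  | zero =>
    simp [precBefore]
  | succ n ih =>
    set k := gapIndex u n (u n) with hk
    set π := gapPerm u s n with hπ
    have hstep : gapPerm u s (n + 1) = inflate π (π k) (s n) := rfl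
    rw [gapIndex_succ_eq_succAbove u n x, gapIndex_succ_eq_succAbove u n y, ← hk, hstep]
    split_ifs with hx hy hy
    · rw [precBefore_succ_of_gapIndex_eq (hx.1.trans hy.1.symm)]
      simp [hx.2, hy.2, not_lt.2 hx.2, not_lt.2 hy.2]
    · rw [inflate_apply_succ, inflate_apply_succAbove]
      by_cases hP : gapIndex u n y = k
      · have hyu : y < u n := not_le.1 fun h => hy ⟨hP, h⟩
        rw [precBefore_succ_of_gapIndex_eq (hx.1.trans hP.symm), hP]
        cases hs : s n <;> simp [hyu, hx.2, not_le.2 hyu, Fin.castSucc_lt_succ.le]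
      · rw [precBefore_succ_of_gapIndex_ne (fun h => hP (h.symm.trans hx.1)), ← ih, hx.1]
        have : π (gapIndex u n y) ≠ π k := fun h => hP (π.injective h)
        exact pivot_lt_succAbove_iff this _
    · rw [inflate_apply_succ, inflate_apply_succAbove]
      by_cases hP : gapIndex u n x = k
      · have hyu : x < u n := not_le.1 fun h => hx ⟨hP, h⟩
        rw [precBefore_succ_of_gapIndex_eq (hP.trans hy.1.symm), hP]
        cases hs : s n <;> simp [hyu, hy.2, not_le.2 hyu, Fin.castSucc_lt_succ.le]
      · rw [precBefore_succ_of_gapIndex_ne (fun h => hP (h.trans hy.1)), ← ih, hy.1]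
        have : π (gapIndex u n x) ≠ π k := fun h => hP (π.injective h)
        exact succAbove_lt_pivot_iff this _
    · rw [inflate_apply_succAbove, inflate_apply_succAbove,
        (Fin.strictMono_succAbove _).lt_iff_lt, ih]
      -- If `x` and `y` share a gap, the new point cannot separate them: one of them would then lie
      -- in the right half.
      by_cases hP : gapIndex u n x = gapIndex u n y
      · have h1 : ¬ precBefore u s n x y := fun h => h.gapIndex_ne hP
        rw [precBefore_succ_of_gapIndex_eq hP]
        simp only [h1, false_iff]
        rintro (⟨hm, -⟩ | ⟨hm, -⟩)
        · refine hy ⟨le_antisymm ?_ (gapIndex_mono u n hm.2), hm.2⟩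
          rw [← hP]
          exact gapIndex_mono u n hm.1.le
        · refine hx ⟨le_antisymm ?_ (gapIndex_mono u n hm.2), hm.2⟩
          rw [hP]
          exact gapIndex_mono u n hm.1.le
      · rw [precBefore_succ_of_gapIndex_ne hP]

/-! ### The relation as a strict total order. -/

theorem prec_irrefl (u : ℕ → I) (s : ℕ → Bool) (x : I) : ¬ prec u s x x := fun h => by
  obtain ⟨n, hn⟩ := h.exists_precBefore
  exact hn.gapIndex_ne rfl

/-- At a level where both relations are decided, transitivity is that of the order on the values of
`gapPerm`. -/
theorem prec_trans {u : ℕ → I} {s : ℕ → Bool} {x y z : I} (hxy : prec u s x y)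
    (hyz : prec u s y z) : prec u s x z := by
  obtain ⟨m, hm⟩ := hxy.exists_precBefore
  obtain ⟨n, hn⟩ := hyz.exists_precBefore
  have h1 := (gapPerm_lt_iff u s _ x y).2 (precBefore_mono (le_max_left m n) hm)
  have h2 := (gapPerm_lt_iff u s _ y z).2 (precBefore_mono (le_max_right m n) hn)
  exact ((gapPerm_lt_iff u s _ x z).1 (h1.trans h2)).prec

theorem isStrictTotalOrder_prec {u : ℕ → I} (s : ℕ → Bool)
    (hu : ∀ x y, x < y → ∃ j, u j ∈ Set.Ioc x y) : IsStrictTotalOrder I (prec u s) where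
  irrefl := prec_irrefl u s
  trans _ _ _ := prec_trans
  trichotomous x y hxy hyx := by
    by_contra hne
    obtain ⟨j, hj⟩ : ∃ j, u j ∈ Set.Ioc (min x y) (max x y) := hu _ _ (by simpa using Ne.symm hne)
    have h : gapIndex u (j + 1) x ≠ gapIndex u (j + 1) y :=
      gapIndex_ne_iff.2 ⟨j, j.lt_succ_self, hj⟩
    rcases lt_or_gt_of_ne ((gapPerm u s (j + 1)).injective.ne h) with h | h
    · exact hxy ((gapPerm_lt_iff u s _ x y).1 h).prec
    · exact hyx ((gapPerm_lt_iff u s _ y x).1 h).prec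

/-! ### The left end points of the gaps -/

/-- The points `0, u 0, u 1, …`: the left end points of the gaps. -/
def gapPoint (u : ℕ → I) : ℕ → I
  | 0 => 0
  | j + 1 => u j

theorem gapIndex_gapPoint_injective {u : ℕ → I} (hu : Function.Injective u) (h0 : ∀ j, u j ≠ 0)
    (n : ℕ) : Function.Injective fun j : Fin (n + 1) => gapIndex u n (gapPoint u j) := by
  have key : ∀ i j : Fin (n + 1), gapPoint u i < gapPoint u j →
      gapIndex u n (gapPoint u i) ≠ gapIndex u n (gapPoint u j) := by
    rintro i ⟨_ | j, hj⟩ h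
    · exact absurd h (not_lt.2 bot_le)
    · exact (gapIndex_lt_of_mem (by omega : j < n) ⟨h, le_rfl⟩).ne
  intro i j hij
  by_contra hne
  rcases lt_trichotomy (gapPoint u i) (gapPoint u j) with h | h | h
  · exact key i j h hij
  · obtain ⟨_ | i, hi⟩ := i <;> obtain ⟨_ | j, hj⟩ := j
    · exact hne rfl
    · exact h0 j h.symm
    · exact h0 i h
    · exact hne (by simpa using hu h)
  · exact key j i h hij.symm

/-- The bijection between the first `n + 1` points and the gaps whose left end points they are. -/
def gapEquiv {u : ℕ → I} (hu : Function.Injective u) (h0 : ∀ j, u j ≠ 0) (n : ℕ) :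
    Equiv.Perm (Fin (n + 1)) :=
  Equiv.ofBijective _ (Finite.injective_iff_bijective.1 (gapIndex_gapPoint_injective hu h0 n))

-- A value counted from `0` is the number of smaller values, and each gap is represented by its left
-- end point. This turns ranks into empirical averages.
open scoped Classical in
theorem gapPerm_eq_card {u : ℕ → I} (hu : Function.Injective u) (h0 : ∀ j, u j ≠ 0)
    (s : ℕ → Bool) (n : ℕ) (x : I) : (gapPerm u s n (gapIndex u n x) : ℕ) =
      (Finset.univ.filter fun j : Fin (n + 1) => precBefore u s n (gapPoint u j) x).card := by
  have h : (Finset.univ.filter fun j : Fin (n + 1) => precBefore u s n (gapPoint u j) x) =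
      (Finset.Iio (gapPerm u s n (gapIndex u n x))).map
        ((gapEquiv hu h0 n).trans (gapPerm u s n)).symm.toEmbedding := by
    ext j
    simp only [Finset.mem_filter, Finset.mem_univ, true_and, Finset.mem_map_equiv,
      Equiv.symm_symm, Finset.mem_Iio]
    exact (gapPerm_lt_iff u s n _ x).symm
  rw [h, Finset.card_map, Fin.card_Iio]

/-! ### Equidistributed points -/

/-- The average of `g` over the points `0, u 0, …, u (n - 1)`. -/
def empAvg (u : ℕ → I) (n : ℕ) (g : I → ℝ) : ℝ :=
  (∑ j : Fin (n + 1), g (gapPoint u j)) / ((n : ℝ) + 1)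

theorem empAvg_mono (u : ℕ → I) (n : ℕ) {g h : I → ℝ} (hgh : ∀ x, g x ≤ h x) :
    empAvg u n g ≤ empAvg u n h :=
  div_le_div_of_nonneg_right (Finset.sum_le_sum fun _ _ => hgh _) (by positivity)

theorem empAvg_add (u : ℕ → I) (n : ℕ) (g h : I → ℝ) :
    empAvg u n (fun x => g x + h x) = empAvg u n g + empAvg u n h := by
  simp [empAvg, Finset.sum_add_distrib, add_div]

theorem empAvg_sub (u : ℕ → I) (n : ℕ) (g h : I → ℝ) :
    empAvg u n (fun x => g x - h x) = empAvg u n g - empAvg u n h := by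
  simp [empAvg, Finset.sum_sub_distrib, sub_div]

theorem empAvg_const (u : ℕ → I) (n : ℕ) (c : ℝ) : empAvg u n (fun _ => c) = c := by
  have : (n : ℝ) + 1 ≠ 0 := by positivity
  simp [empAvg]
  field_simp

theorem empAvg_sum {ι : Type*} (t : Finset ι) (u : ℕ → I) (n : ℕ) (c : ι → ℝ) (g : ι → I → ℝ) :
    empAvg u n (fun x => ∑ i ∈ t, c i * g i x) = ∑ i ∈ t, c i * empAvg u n (g i) := by
  simp only [empAvg, Finset.sum_comm (s := Finset.univ), Finset.sum_div, mul_div_assoc,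
    Finset.mul_sum]

theorem abs_empAvg_sub_le (u : ℕ → I) (n : ℕ) {g h : I → ℝ} {c : ℝ}
    (hgh : ∀ x, |g x - h x| ≤ c) : |empAvg u n g - empAvg u n h| ≤ c := by
  rw [← empAvg_sub, abs_le]
  constructor
  · rw [← empAvg_const u n (-c)]
    exact empAvg_mono u n fun x => (abs_le.1 (hgh x)).1
  · rw [← empAvg_const u n c]
    exact empAvg_mono u n fun x => (abs_le.1 (hgh x)).2

/-- The points `u 0, u 1, …` are distinct and positive, and their empirical distribution functions
converge to that of the Lebesgue measure on a countable dense set. -/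
structure Equidistributed (u : ℕ → I) : Prop where
  injective : Function.Injective u
  ne_zero : ∀ j, u j ≠ 0
  tendsto_Iic : ∀ k, Tendsto
    (fun n => empAvg u n ((Set.Iic (TopologicalSpace.denseSeq I k)).indicator 1)) atTop
    (𝓝 (TopologicalSpace.denseSeq I k : ℝ))

theorem exists_denseSeq_between {a b : ℝ} (ha : 0 ≤ a) (hab : a < b) (hb : b ≤ 1) :
    ∃ k, a < TopologicalSpace.denseSeq I k ∧ TopologicalSpace.denseSeq I k < b := by
  have h : (⟨a, ha, hab.le.trans hb⟩ : I) < ⟨b, ha.trans hab.le, hb⟩ := hab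
  obtain ⟨_, ⟨k, rfl⟩, h1, h2⟩ := (TopologicalSpace.denseRange_denseSeq I).exists_between h
  exact ⟨k, h1, h2⟩

theorem volume_real_Iic (x : I) : (volume : Measure I).real (Set.Iic x) = x := by
  rw [measureReal_def, unitInterval.volume_Iic, ENNReal.toReal_ofReal x.2.1]

theorem indicator_one_mono {A B : Set I} (h : A ⊆ B) (x : I) :
    A.indicator (1 : I → ℝ) x ≤ B.indicator 1 x :=
  Set.indicator_le_indicator_of_subset h (fun _ => zero_le_one) x

/-- A lower set is an initial interval, so it is compared from inside and outside with intervals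
ending at points of the dense sequence. Open and closed ends need no distinction. -/
theorem Equidistributed.tendsto_of_isLowerSet {u : ℕ → I} (hu : Equidistributed u) {A : Set I}
    (hA : IsLowerSet A) :
    Tendsto (fun n => empAvg u n (A.indicator 1)) atTop (𝓝 (volume.real A)) := by
  refine tendsto_order.2 ⟨fun c hc => ?_, fun c hc => ?_⟩
  · rcases lt_or_ge c 0 with h0 | h0
    · refine Eventually.of_forall fun n => h0.trans_le ?_
      rw [← empAvg_const u n 0]
      exact empAvg_mono u n fun x => Set.indicator_nonneg (fun _ _ => zero_le_one) x
    obtain ⟨k, h1, h2⟩ := exists_denseSeq_between h0 hc measureReal_le_one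
    have hk : TopologicalSpace.denseSeq I k ∈ A := by
      by_contra hk
      have hsub : A ⊆ Set.Iic (TopologicalSpace.denseSeq I k) := fun x hx =>
        not_lt.1 fun h => hk (hA h.le hx)
      have := measureReal_mono hsub (μ := volume)
      rw [volume_real_Iic] at this
      exact h2.not_ge this
    filter_upwards [(tendsto_order.1 (hu.tendsto_Iic k)).1 c h1] with n hn
    exact hn.trans_le (empAvg_mono u n (indicator_one_mono fun x hx => hA hx hk))
  · rcases lt_or_ge 1 c with h1 | h1
    · refine Eventually.of_forall fun n => lt_of_le_of_lt ?_ h1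
      rw [← empAvg_const u n 1]
      exact empAvg_mono u n fun x => Set.indicator_le_self' (fun _ _ => zero_le_one) x
    obtain ⟨k, h1, h2⟩ := exists_denseSeq_between measureReal_nonneg hc h1
    have hk : TopologicalSpace.denseSeq I k ∉ A := fun hk => by
      have hsub : Set.Iic (TopologicalSpace.denseSeq I k) ⊆ A := fun x hx => hA hx hk
      have := measureReal_mono hsub (μ := volume)
      rw [volume_real_Iic] at this
      exact h1.not_ge this
    filter_upwards [(tendsto_order.1 (hu.tendsto_Iic k)).2 c h2] with n hn
    exact lt_of_le_of_lt (empAvg_mono u n (indicator_one_mono fun x hx =>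
      not_lt.1 fun h => hk (hA h.le hx))) hn

theorem measurable_gapIndex (u : ℕ → I) (n : ℕ) : Measurable (gapIndex u n) := by
  refine measurable_to_countable' fun i => Set.OrdConnected.measurableSet ?_
  exact Set.ordConnected_singleton.preimage_mono (gapIndex_mono u n)

theorem integral_comp_gapIndex (u : ℕ → I) (m : ℕ) (h : Fin (m + 1) → ℝ) :
    ∫ x, h (gapIndex u m x) = ∑ i, h i * volume.real (gapIndex u m ⁻¹' {i}) := by
  have hm := measurable_gapIndex u m
  rw [← integral_map hm.aemeasurable (by fun_prop : StronglyMeasurable h).aestronglyMeasurable,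
    integral_fintype (.of_finite)]
  refine Finset.sum_congr rfl fun i _ => ?_
  rw [map_measureReal_apply hm (MeasurableSet.singleton i), smul_eq_mul, mul_comm]

/-- The function is a finite combination of indicators of gaps, and each gap is a difference of two
lower sets. -/
theorem Equidistributed.tendsto_comp_gapIndex {u : ℕ → I} (hu : Equidistributed u) (m : ℕ)
    (h : Fin (m + 1) → ℝ) : Tendsto (fun n => empAvg u n fun x => h (gapIndex u m x)) atTop
      (𝓝 (∫ x, h (gapIndex u m x))) := by
  have hind : ∀ i, Tendsto (fun n => empAvg u n ((gapIndex u m ⁻¹' {i}).indicator 1)) atTop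
      (𝓝 (volume.real (gapIndex u m ⁻¹' {i}))) := fun i => by
    have hsub : gapIndex u m ⁻¹' Set.Iio i ⊆ gapIndex u m ⁻¹' Set.Iic i :=
      Set.preimage_mono Set.Iio_subset_Iic_self
    have hdiff : gapIndex u m ⁻¹' {i} =
        gapIndex u m ⁻¹' Set.Iic i \ gapIndex u m ⁻¹' Set.Iio i := by
      rw [← Set.preimage_sdiff]
      rw [Set.Iic_sdiff_Iio_same]
    have h1 := (hu.tendsto_of_isLowerSet ((isLowerSet_Iic i).preimage (gapIndex_mono u m))).sub
      (hu.tendsto_of_isLowerSet ((isLowerSet_Iio i).preimage (gapIndex_mono u m)))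
    rw [hdiff, measureReal_sdiff hsub (measurable_gapIndex u m measurableSet_Iio)]
    refine h1.congr fun n => ?_
    rw [← empAvg_sub]
    congr 1
    ext x
    by_cases h2 : gapIndex u m x < i
    · simp [Set.indicator, h2, h2.le]
    · simp [Set.indicator, h2]
  rw [integral_comp_gapIndex]
  refine (tendsto_finsetSum _ fun i _ => (hind i).const_mul (h i)).congr fun n => ?_
  rw [← empAvg_sum]
  congr 1
  ext x
  rw [Finset.sum_eq_single (gapIndex u m x)] <;> simp +contextual [Set.indicator, eq_comm]

/-- Otherwise two distinct dense points between `x` and `y` would have the same empirical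
frequencies, hence the same limit. -/
theorem Equidistributed.exists_mem_Ioc {u : ℕ → I} (hu : Equidistributed u) {x y : I}
    (hxy : x < y) : ∃ j, u j ∈ Set.Ioc x y := by
  by_contra! H
  obtain ⟨k, h1, h2⟩ := exists_denseSeq_between x.2.1 hxy y.2.2
  obtain ⟨l, h3, h4⟩ := exists_denseSeq_between (h1.le.trans' x.2.1) h2 y.2.2
  refine h3.ne (tendsto_nhds_unique (hu.tendsto_Iic k) ((hu.tendsto_Iic l).congr fun n => ?_))
  rw [empAvg, empAvg]
  congr 1
  refine Finset.sum_congr rfl fun j _ => ?_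
  suffices h : gapPoint u j ∈ Set.Iic (TopologicalSpace.denseSeq I l) ↔
      gapPoint u j ∈ Set.Iic (TopologicalSpace.denseSeq I k) by
    classical
    simp only [Set.indicator_apply, h]
  obtain ⟨_ | j, hj⟩ := j
  · exact iff_of_true (Set.mem_Iic.2 bot_le) (Set.mem_Iic.2 bot_le)
  · refine ⟨fun h => ?_, fun h => le_trans h (le_of_lt h3)⟩
    refine (not_lt.1 fun hx => H j ⟨hx, le_trans h (le_of_lt h4)⟩ : u j ≤ x).trans (le_of_lt h1)

/-- The gaps become small. -/
theorem Equidistributed.exists_dist_le {u : ℕ → I} (hu : Equidistributed u) {ε : ℝ}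
    (hε : 0 < ε) : ∃ m, ∀ x y, gapIndex u m x = gapIndex u m y → |(x : ℝ) - y| ≤ ε := by
  -- The mesh `1 / K` is below `ε / 2`, so an interval longer than `ε` contains a full grid cell,
  -- and each cell contains a point. The cell used below starts at `⌈x * K⌉₊ / K`.
  obtain ⟨K, hK⟩ := exists_nat_gt (2 / ε)
  have hK0 : (0 : ℝ) < K := lt_trans (by positivity) hK
  have hI : ∀ l ≤ K, (l : ℝ) / K ∈ I := fun l hl =>
    ⟨by positivity, (div_le_one hK0).2 (by exact_mod_cast hl)⟩
  have H : ∀ l : Fin K, ∃ j, u j ∈ Set.Ioc (⟨_, hI l l.2.le⟩ : I) ⟨_, hI (l + 1) l.2⟩ := fun l =>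
    hu.exists_mem_Ioc (Subtype.mk_lt_mk.2 (by gcongr; simp))
  choose j hj using H
  obtain ⟨m, hm⟩ := (Set.finite_range j).bddAbove
  refine ⟨m + 1, ?_⟩
  have key : ∀ x y : I, x < y → gapIndex u (m + 1) x = gapIndex u (m + 1) y →
      (y : ℝ) - x ≤ ε := fun x y hxy h => by
    by_contra! hlt
    have h2 : 2 < ε * K := by rwa [div_lt_iff₀' hε] at hK
    have h3 : (⌈(x : ℝ) * K⌉₊ : ℝ) < x * K + 1 := Nat.ceil_lt_add_one (by have := x.2.1; positivity)
    have h4 : (x : ℝ) * K ≤ ⌈(x : ℝ) * K⌉₊ := Nat.le_ceil _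
    have h5 : (⌈(x : ℝ) * K⌉₊ : ℝ) + 1 < y * K := by nlinarith
    have h6 : (y : ℝ) * K ≤ K := mul_le_of_le_one_left hK0.le y.2.2
    have hl : ⌈(x : ℝ) * K⌉₊ < K := by
      have : (⌈(x : ℝ) * K⌉₊ : ℝ) < K := by linarith
      exact_mod_cast this
    refine (gapIndex_lt_of_mem (Nat.lt_succ_of_le (hm ⟨⟨_, hl⟩, rfl⟩))
      ⟨lt_of_le_of_lt ?_ (hj ⟨_, hl⟩).1, (hj ⟨_, hl⟩).2.trans ?_⟩).ne h
    · exact Subtype.coe_le_coe.1 ((le_div_iff₀ hK0).2 h4)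
    · refine Subtype.coe_le_coe.1 ((div_le_iff₀ hK0).2 ?_)
      push_cast
      exact h5.le
  intro x y h
  rcases lt_trichotomy x y with hxy | rfl | hxy
  · rw [abs_sub_comm, abs_of_pos (sub_pos.2 (Subtype.coe_lt_coe.2 hxy))]
    exact key x y hxy h
  · simpa using hε.le
  · rw [abs_of_pos (sub_pos.2 (Subtype.coe_lt_coe.2 hxy))]
    exact key y x hxy h.symm

theorem volume_real_gap_le {u : ℕ → I} {m : ℕ} {ε : ℝ} (hε : 0 ≤ ε)
    (h : ∀ x y, gapIndex u m x = gapIndex u m y → |(x : ℝ) - y| ≤ ε) (i : Fin (m + 1)) :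
    (volume : Measure I).real (gapIndex u m ⁻¹' {i}) ≤ ε := by
  refine ENNReal.toReal_le_of_le_ofReal hε ?_
  rw [unitInterval.volume_apply]
  refine (Real.volume_le_diam _).trans (Metric.ediam_le ?_)
  rintro _ ⟨x, hx, rfl⟩ _ ⟨y, hy, rfl⟩
  rw [edist_dist]
  exact ENNReal.ofReal_le_ofReal (h x y (hx.trans hy.symm))

/-! ### Ranks converge to `phi` -/

open scoped Classical in
/-- The indicator function of `precBefore u s m y x`, as a function of the indices of the gaps that
contain `y` and `x`. -/
def gapLT (u : ℕ → I) (s : ℕ → Bool) (m : ℕ) (i k : Fin (m + 1)) : ℝ :=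
  if gapPerm u s m k < gapPerm u s m i then 1 else 0

/-- The indicator function of the equality of the indices of two gaps. -/
def gapEq (m : ℕ) (i k : Fin (m + 1)) : ℝ := if k = i then 1 else 0

theorem integral_gapEq (u : ℕ → I) (m : ℕ) (i : Fin (m + 1)) :
    ∫ y, gapEq m i (gapIndex u m y) = (volume : Measure I).real (gapIndex u m ⁻¹' {i}) := by
  rw [integral_comp_gapIndex]
  simp [gapEq]

open scoped Classical in
theorem gapLT_eq_indicator (u : ℕ → I) (s : ℕ → Bool) (m : ℕ) (x y : I) :
    gapLT u s m (gapIndex u m x) (gapIndex u m y) = if precBefore u s m y x then 1 else 0 := by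
  simp only [gapLT, gapPerm_lt_iff]

theorem integrable_comp_gapIndex (u : ℕ → I) (m : ℕ) (h : Fin (m + 1) → ℝ) :
    Integrable (fun y => h (gapIndex u m y)) volume :=
  (Integrable.of_finite (f := h) (μ := volume.map (gapIndex u m))).comp_measurable
    (measurable_gapIndex u m)

theorem measurableSet_setOf_prec (u : ℕ → I) (s : ℕ → Bool) (x : I) :
    MeasurableSet {y | prec u s y x} :=
  measurable_prodMk_left (x := x) (measurableSet_prec u s)

/-- After `m` points, `y ≺ x` is undecided only for `y` in the gap of `x`, so the error is at most
the measure of that gap. -/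
theorem phi_mem (u : ℕ → I) (s : ℕ → Bool) (m : ℕ) (x : I) :
    ∫ y, gapLT u s m (gapIndex u m x) (gapIndex u m y) ≤ phi u s x ∧
    phi u s x ≤ (∫ y, gapLT u s m (gapIndex u m x) (gapIndex u m y)) +
      ∫ y, gapEq m (gapIndex u m x) (gapIndex u m y) := by
  classical
  have hphi : (phi u s x : ℝ) = ∫ y, {y | prec u s y x}.indicator 1 y := by
    rw [integral_indicator_one (measurableSet_setOf_prec u s x)]
    rfl
  have hint : Integrable ({y | prec u s y x}.indicator (1 : I → ℝ)) volume :=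
    (integrable_const (1 : ℝ)).indicator (measurableSet_setOf_prec u s x)
  have hL := integrable_comp_gapIndex u m (gapLT u s m (gapIndex u m x))
  have hE := integrable_comp_gapIndex u m (gapEq m (gapIndex u m x))
  rw [hphi, ← integral_add hL hE]
  refine ⟨integral_mono hL hint fun y => ?_, integral_mono hint (hL.add hE) fun y => ?_⟩
  · simp only [gapLT_eq_indicator, Set.indicator_apply, Set.mem_ofPred_eq]
    split_ifs with h1 h2 <;> first | norm_num; done | exact absurd h1.prec h2
  · simp only [gapLT_eq_indicator, Set.indicator_apply, Set.mem_ofPred_eq, gapEq]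
    split_ifs with h1 h2 h3 h3 <;> first | norm_num; done | exact absurd (h1.precBefore h3) h2

/-- The sandwich of `phi_mem` for ranks, with empirical averages in place of integrals. -/
theorem gapPerm_div_mem {u : ℕ → I} (hu : Equidistributed u) (s : ℕ → Bool) {m n : ℕ}
    (hmn : m ≤ n) (x : I) :
    empAvg u n (fun y => gapLT u s m (gapIndex u m x) (gapIndex u m y)) ≤
      (gapPerm u s n (gapIndex u n x) : ℝ) / (n + 1) ∧
    (gapPerm u s n (gapIndex u n x) : ℝ) / (n + 1) ≤
      empAvg u n (fun y => gapLT u s m (gapIndex u m x) (gapIndex u m y)) +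
        empAvg u n (fun y => gapEq m (gapIndex u m x) (gapIndex u m y)) := by
  classical
  have h : (gapPerm u s n (gapIndex u n x) : ℝ) / (n + 1) =
      empAvg u n fun y => if precBefore u s n y x then 1 else 0 := by
    rw [gapPerm_eq_card hu.injective hu.ne_zero, empAvg, Finset.sum_boole]
  rw [h, ← empAvg_add]
  refine ⟨empAvg_mono u n fun y => ?_, empAvg_mono u n fun y => ?_⟩
  · simp only [gapLT_eq_indicator]
    split_ifs with h1 h2 <;> first | norm_num; done | exact absurd (precBefore_mono hmn h1) h2
  · simp only [gapLT_eq_indicator, gapEq]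
    split_ifs with h1 h2 h3 h3 <;>
      first | norm_num; done | exact absurd (h1.prec.precBefore h3) h2

/-- Uniformity in `x` holds because the bounds at level `m` involve finitely many gaps. The three
thirds of `ε` pay for the two empirical averages and for the measure of a gap. -/
theorem Equidistributed.eventually_rank_sub_phi_le {u : ℕ → I} (hu : Equidistributed u)
    (s : ℕ → Bool) {ε : ℝ} (hε : 0 < ε) : ∀ᶠ n in atTop, ∀ x,
      |(gapPerm u s n (gapIndex u n x) : ℝ) / (n + 1) - phi u s x| ≤ ε := by
  obtain ⟨m, hm⟩ := hu.exists_dist_le (by positivity : 0 < ε / 3)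
  have h1 : ∀ᶠ n in atTop, ∀ i : Fin (m + 1),
      |empAvg u n (fun y => gapLT u s m i (gapIndex u m y)) - ∫ y, gapLT u s m i (gapIndex u m y)|
        < ε / 3 := eventually_all.2 fun i => by
    simpa [Real.dist_eq] using Metric.tendsto_nhds.1
      (hu.tendsto_comp_gapIndex m (gapLT u s m i)) _ (by positivity : 0 < ε / 3)
  have h2 : ∀ᶠ n in atTop, ∀ i : Fin (m + 1),
      |empAvg u n (fun y => gapEq m i (gapIndex u m y)) - ∫ y, gapEq m i (gapIndex u m y)|
        < ε / 3 := eventually_all.2 fun i => by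
    simpa [Real.dist_eq] using Metric.tendsto_nhds.1
      (hu.tendsto_comp_gapIndex m (gapEq m i)) _ (by positivity : 0 < ε / 3)
  filter_upwards [h1, h2, eventually_ge_atTop m] with n h1 h2 hn x
  have h3 := abs_lt.1 (h1 (gapIndex u m x))
  have h4 := abs_lt.1 (h2 (gapIndex u m x))
  have h5 := gapPerm_div_mem hu s hn x
  have h6 := phi_mem u s m x
  have h7 := volume_real_gap_le (by positivity) hm (gapIndex u m x)
  rw [← integral_gapEq] at h7
  rw [abs_le]
  constructor <;> linarith

/-! ### The order for equidistributed points, and the case of positive signs. -/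

theorem Equidistributed.isStrictTotalOrder_prec {u : ℕ → I} (hu : Equidistributed u)
    (s : ℕ → Bool) : IsStrictTotalOrder I (prec u s) :=
  RecSep.isStrictTotalOrder_prec s fun _ _ => hu.exists_mem_Ioc

theorem prec_true_iff {u : ℕ → I} (hu : Equidistributed u) (x y : I) :
    prec u (fun _ => true) x y ↔ x < y := by
  have h : ∀ x y, prec u (fun _ => true) x y → x < y := fun x y ⟨j, _, h⟩ => by simpa using h
  refine ⟨h x y, fun hxy => ?_⟩
  by_contra hn
  exact hxy.ne ((hu.isStrictTotalOrder_prec fun _ => true).trichotomous x y hn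
    fun h' => hxy.not_gt (h y x h'))

theorem phi_true {u : ℕ → I} (hu : Equidistributed u) (x : I) : phi u (fun _ => true) x = x := by
  have h : {y | prec u (fun _ => true) y x} = Set.Iio x := Set.ext fun y => prec_true_iff hu y x
  ext
  simp [phi, h, measureReal_def, x.2.1]

theorem perm_eq_one_of_strictMono {n : ℕ} {ρ : Equiv.Perm (Fin n)} (h : StrictMono ρ) : ρ = 1 := by
  ext i
  have := congrArg (fun e : Fin n ≃o Fin n => e i)
    (Subsingleton.elim (h.orderIsoOfSurjective _ ρ.surjective) (OrderIso.refl _))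
  simpa using congrArg Fin.val this

theorem gapPerm_true {u : ℕ → I} (hu : Equidistributed u) (n : ℕ) :
    gapPerm u (fun _ => true) n = 1 := perm_eq_one_of_strictMono fun i j hij => by
  obtain ⟨a, rfl⟩ := (gapEquiv hu.injective hu.ne_zero n).surjective i
  obtain ⟨b, rfl⟩ := (gapEquiv hu.injective hu.ne_zero n).surjective j
  refine (gapPerm_lt_iff u _ n _ _).2 (((prec_true_iff hu _ _).2 ?_).precBefore hij.ne)
  exact not_le.1 fun hle => (gapIndex_mono u n hle).not_gt hij

/-- With all signs positive, `gapPerm` and `phi` are identities, so convergence of positions is a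
special case of convergence of ranks. -/
theorem Equidistributed.eventually_gapIndex_sub_le {u : ℕ → I} (hu : Equidistributed u)
    {ε : ℝ} (hε : 0 < ε) : ∀ᶠ n in atTop, ∀ x,
      |(gapIndex u n x : ℝ) / (n + 1) - x| ≤ ε := by
  filter_upwards [hu.eventually_rank_sub_phi_le (fun _ => true) hε] with n hn x
  simpa [gapPerm_true hu, phi_true hu] using hn x

/-! ### Convergence of averages -/

theorem abs_phi_sub_le {u : ℕ → I} {s : ℕ → Bool} {m : ℕ} {ε : ℝ} (hε : 0 ≤ ε)
    (h : ∀ x y, gapIndex u m x = gapIndex u m y → |(x : ℝ) - y| ≤ ε) {x y : I}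
    (hxy : gapIndex u m x = gapIndex u m y) : |(phi u s x : ℝ) - phi u s y| ≤ ε := by
  have h1 := phi_mem u s m x
  have h2 := phi_mem u s m y
  have h3 := volume_real_gap_le hε h (gapIndex u m y)
  rw [hxy] at h1
  rw [← integral_gapEq] at h3
  rw [abs_le]
  constructor <;> linarith

theorem abs_integral_sub_le {α : Type*} [MeasurableSpace α] {μ : Measure α} [IsProbabilityMeasure μ]
    {g h : α → ℝ} (hg : Integrable g μ) (hh : Integrable h μ) {c : ℝ}
    (hgh : ∀ᵐ x ∂μ, |g x - h x| ≤ c) : |(∫ x, g x ∂μ) - ∫ x, h x ∂μ| ≤ c := by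
  rw [← integral_sub hg hh]
  have h1 : ∀ᵐ x ∂μ, ‖g x - h x‖ ≤ c := hgh
  simpa using norm_integral_le_of_norm_le_const h1

/-- No continuity of `phi` is available, but it varies little inside small gaps. The integrand is
therefore uniformly close to a function of the gap index. -/
theorem Equidistributed.tendsto_empAvg {u : ℕ → I} (hu : Equidistributed u) (s : ℕ → Bool)
    {f : I × I → ℝ} (hf : Continuous f) : Tendsto (fun n => empAvg u n fun x => f (x, phi u s x))
      atTop (𝓝 (∫ x, f (x, phi u s x))) := by
  refine Metric.tendsto_nhds.2 fun ε hε => ?_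
  obtain ⟨δ, hδ, hfδ⟩ := Metric.uniformContinuous_iff.1
    (CompactSpace.uniformContinuous_of_continuous hf) (ε / 4) (by positivity)
  obtain ⟨m, hm⟩ := hu.exists_dist_le (by positivity : 0 < δ / 2)
  set g : I → ℝ := fun x => f (x, phi u s x) with hg
  -- `invFun` picks a representative in each gap; its junk value at an index not attained is never
  -- evaluated at a point.
  set h : Fin (m + 1) → ℝ := fun i => g (Function.invFun (gapIndex u m) i) with hh
  have hgh : ∀ x, |g x - h (gapIndex u m x)| ≤ ε / 4 := fun x => by
    have hx : gapIndex u m x = gapIndex u m (Function.invFun (gapIndex u m) (gapIndex u m x)) :=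
      (Function.invFun_eq ⟨x, rfl⟩).symm
    refine (hfδ (max_lt ?_ ?_)).le
    · exact (hm _ _ hx).trans_lt (by linarith)
    · exact (abs_phi_sub_le (by positivity) hm hx).trans_lt (by linarith)
  have hgm : Measurable g := hf.measurable.comp (measurable_id.prodMk (measurable_phi u s))
  have hgi : Integrable g volume := by
    obtain ⟨C, hC⟩ := isCompact_univ.exists_bound_of_continuousOn hf.continuousOn
    exact .of_bound hgm.aestronglyMeasurable C (.of_forall fun x => hC _ trivial)
  have h1 : |(∫ x, g x) - ∫ x, h (gapIndex u m x)| ≤ ε / 4 :=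
    abs_integral_sub_le hgi (integrable_comp_gapIndex u m h) (.of_forall hgh)
  filter_upwards [Metric.tendsto_nhds.1 (hu.tendsto_comp_gapIndex m h) (ε / 4) (by positivity)]
    with n hn
  have h2 := abs_empAvg_sub_le u n hgh
  rw [Real.dist_eq] at hn ⊢
  rw [abs_le] at h1 h2
  rw [abs_lt] at hn ⊢
  constructor <;> linarith

/-! ### Permutons of permutations -/

/-- The `i`-th of `n` closed subintervals of equal length of the unit interval. -/
def gridInterval (n : ℕ) (i : Fin n) : Set I :=
  {x | (x : ℝ) ∈ Set.Icc ((i : ℝ) / n) (((i : ℝ) + 1) / n)}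

theorem cell_eq_prod {n : ℕ} (i j : Fin n) :
    cell n i j = gridInterval n i ×ˢ gridInterval n j := rfl

theorem measurableSet_gridInterval {n : ℕ} (i : Fin n) : MeasurableSet (gridInterval n i) :=
  measurable_subtype_coe measurableSet_Icc

theorem volume_gridInterval {n : ℕ} (i : Fin n) : volume (gridInterval n i) = (n : ℝ≥0∞)⁻¹ := by
  have hn : (0 : ℝ) < n := by exact_mod_cast i.pos
  have h0 : (i : ℝ) / n ∈ I := ⟨by positivity, (div_le_one hn).2 (by exact_mod_cast i.isLt.le)⟩
  have h1 : ((i : ℝ) + 1) / n ∈ I := ⟨by positivity, (div_le_one hn).2 (by exact_mod_cast i.isLt)⟩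
  have h : gridInterval n i = Set.Icc (⟨_, h0⟩ : I) ⟨_, h1⟩ := rfl
  rw [h, unitInterval.volume_Icc, ← sub_div, add_sub_cancel_left, one_div,
    ENNReal.ofReal_inv_of_pos hn, ENNReal.ofReal_natCast]

/-- The closed intervals cover `I` and overlap at most in single points, which are null. -/
theorem sum_restrict_gridInterval (n : ℕ) :
    ∑ i, (volume : Measure I).restrict (gridInterval (n + 1) i) = volume := by
  have hd : ∀ i j : Fin (n + 1), i < j →
      volume (gridInterval (n + 1) i ∩ gridInterval (n + 1) j) = 0 := fun i j hij => by
    refine Set.Subsingleton.measure_zero (fun x hx y hy => ?_) _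
    have key : ∀ z ∈ gridInterval (n + 1) i ∩ gridInterval (n + 1) j,
        (z : ℝ) = j / (n + 1 : ℕ) := fun z hz => by
      refine le_antisymm (hz.1.2.trans ?_) hz.2.1
      gcongr
      exact_mod_cast hij
    exact Subtype.ext ((key x hx).trans (key y hy).symm)
  have hd' : Pairwise (Function.onFun (AEDisjoint volume) (gridInterval (n + 1))) :=
    fun i j hij => by
      rcases lt_or_gt_of_ne hij with h | h
      · exact hd i j h
      · exact AEDisjoint.symm (hd j i h)
  have hU : ⋃ i, gridInterval (n + 1) i = Set.univ := by
    refine Set.eq_univ_of_forall fun x => Set.mem_iUnion.2 ?_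
    have hn : (0 : ℝ) < (n + 1 : ℕ) := by positivity
    have h0 : 0 ≤ (x : ℝ) * (n + 1 : ℕ) := mul_nonneg x.2.1 hn.le
    rcases x.2.2.lt_or_eq with hx | hx
    · refine ⟨⟨⌊(x : ℝ) * (n + 1 : ℕ)⌋₊, (Nat.floor_lt h0).2 (mul_lt_of_lt_one_left hn hx)⟩, ?_, ?_⟩
      · exact (div_le_iff₀ hn).2 (Nat.floor_le h0)
      · exact (le_div_iff₀ hn).2 (Nat.lt_floor_add_one _).le
    · refine ⟨Fin.last n, ?_, ?_⟩
      · rw [hx, Fin.val_last]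
        exact (div_le_one hn).2 (by push_cast; linarith)
      · rw [hx, Fin.val_last]
        exact (one_le_div hn).2 (by push_cast; linarith)
  rw [← Measure.sum_fintype, ← Measure.restrict_iUnion_ae hd'
    fun i => (measurableSet_gridInterval i).nullMeasurableSet, hU, Measure.restrict_univ]

theorem cond_cell_eq {n : ℕ} (i j : Fin n) : (volume[|cell n i j] : Measure (I × I)) =
    ((n : ℝ≥0∞) * n) • (volume.restrict (gridInterval n i)).prod
      (volume.restrict (gridInterval n j)) := by
  have hn : (n : ℝ≥0∞) ≠ 0 := by exact_mod_cast i.pos.ne'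
  rw [ProbabilityTheory.cond, cell_eq_prod, Measure.volume_eq_prod, Measure.prod_restrict,
    Measure.prod_prod, volume_gridInterval, volume_gridInterval,
    ENNReal.mul_inv (by simp) (by simp), inv_inv]

theorem isPermuton_permPermuton {n : ℕ} (π : Equiv.Perm (Fin (n + 1))) :
    IsPermuton (permPermuton π) := by
  have hn : ((n : ℝ≥0∞) + 1) ≠ 0 := by simp
  have hn' : ((n : ℝ≥0∞) + 1) ≠ ∞ := by simp
  have hc : ((n : ℝ≥0∞) + 1)⁻¹ * (((n : ℝ≥0∞) + 1) * (n + 1) * ((n : ℝ≥0∞) + 1)⁻¹) = 1 := by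
    rw [mul_assoc, ENNReal.mul_inv_cancel hn hn', mul_one, ENNReal.inv_mul_cancel hn hn']
  constructor
  · change (permMeasure π).map Prod.fst = volume
    rw [permMeasure, Measure.map_smul, ← Measure.mapₗ_apply_of_measurable measurable_fst, map_sum]
    simp only [Measure.mapₗ_apply_of_measurable measurable_fst, cond_cell_eq, Measure.map_smul,
      Measure.map_fst_prod, Measure.restrict_apply_univ, volume_gridInterval, ← Finset.smul_sum,
      sum_restrict_gridInterval, smul_smul, Nat.cast_add, Nat.cast_one, hc, one_smul]
  · change (permMeasure π).map Prod.snd = volume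
    rw [permMeasure, Measure.map_smul, ← Measure.mapₗ_apply_of_measurable measurable_snd, map_sum]
    simp only [Measure.mapₗ_apply_of_measurable measurable_snd, cond_cell_eq, Measure.map_smul,
      Measure.map_snd_prod, Measure.restrict_apply_univ, volume_gridInterval, ← Finset.smul_sum,
      smul_smul, Nat.cast_add, Nat.cast_one]
    -- Each row is used exactly once because `π` is a bijection.
    rw [Equiv.sum_comp π fun i => (volume : Measure I).restrict (gridInterval (n + 1) i),
      sum_restrict_gridInterval, hc, one_smul]

theorem IsPermuton.of_tendsto {ν : ℕ → ProbabilityMeasure (I × I)} {μ : ProbabilityMeasure (I × I)}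
    (hν : ∀ n, IsPermuton (ν n)) (h : Tendsto ν atTop (𝓝 μ)) : IsPermuton μ := by
  have key : ∀ f : I × I → I, Continuous f → (∀ n, (ν n : Measure (I × I)).map f = volume) →
      (μ : Measure (I × I)).map f = volume := fun f hf hν => by
    have h1 := ProbabilityMeasure.tendsto_map_of_tendsto_of_continuous ν μ h hf
    have h2 : ∀ n, (ν n).map hf.measurable.aemeasurable = (ν 0).map hf.measurable.aemeasurable :=
      fun n => Subtype.ext ((hν n).trans (hν 0).symm)
    have h3 := tendsto_nhds_unique h1 (tendsto_const_nhds.congr fun n => (h2 n).symm)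
    exact (congrArg (fun ρ : ProbabilityMeasure I => (ρ : Measure I)) h3).trans (hν 0)
  exact ⟨key _ continuous_fst fun n => (hν n).1, key _ continuous_snd fun n => (hν n).2⟩

theorem integral_permMeasure {n : ℕ} (π : Equiv.Perm (Fin (n + 1))) {f : I × I → ℝ}
    (hf : Continuous f) : ∫ z, f z ∂(permMeasure π) =
      (∑ i, ∫ z, f z ∂(volume[|cell (n + 1) i (π i)])) / ((n : ℝ) + 1) := by
  rw [permMeasure, integral_smul_measure, integral_finsetSum_measure]
  · rw [ENNReal.toReal_inv, smul_eq_mul, ENNReal.toReal_add (by simp) (by simp),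
      ENNReal.toReal_natCast, ENNReal.toReal_one, inv_mul_eq_div]
  · intro i _
    exact (BoundedContinuousFunction.mkOfCompact ⟨f, hf⟩).integrable _

theorem measurable_graph_phi (u : ℕ → I) (s : ℕ → Bool) : Measurable fun x => (x, phi u s x) :=
  measurable_id.prodMk (measurable_phi u s)

/-- The cell of the gap containing `x` is uniformly close to `(x, phi u s x)`. Replacing cells by
these points gives an empirical average, to which `tendsto_empAvg` applies. -/
theorem Equidistributed.tendsto_gapPerm {u : ℕ → I} (hu : Equidistributed u) (s : ℕ → Bool) :
    Tendsto (fun n => permPermuton (gapPerm u s n)) atTop (𝓝 (muRec u s)) := by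
  refine ProbabilityMeasure.tendsto_iff_forall_integral_tendsto.2 fun f => ?_
  change Tendsto (fun n => ∫ z, f z ∂(permMeasure (gapPerm u s n))) atTop
    (𝓝 (∫ z, f z ∂((volume : Measure I).map fun x => (x, phi u s x))))
  rw [integral_map (measurable_graph_phi u s).aemeasurable
    f.continuous.measurable.aestronglyMeasurable]
  refine Metric.tendsto_nhds.2 fun ε hε => ?_
  obtain ⟨δ, hδ, hfδ⟩ := Metric.uniformContinuous_iff.1
    (CompactSpace.uniformContinuous_of_continuous f.continuous) (ε / 2) (by positivity)
  -- Half of `δ` is for the side of a cell, half for the distance from its corner to `(x, phi u s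
  -- x)`, coordinate by coordinate.
  have hlarge : ∀ᶠ n : ℕ in atTop, 1 / ((n : ℝ) + 1) < δ / 2 :=
    (tendsto_order.1 tendsto_one_div_add_atTop_nhds_zero_nat).2 _ (by positivity)
  filter_upwards [hlarge, hu.eventually_gapIndex_sub_le (by positivity : 0 < δ / 2),
    hu.eventually_rank_sub_phi_le s (by positivity : 0 < δ / 2),
    Metric.tendsto_nhds.1 (hu.tendsto_empAvg s f.continuous) (ε / 2) (by positivity)]
    with n hn h1 h2 h3
  have hgrid : ∀ (i : Fin (n + 1)) (z a : I), z ∈ gridInterval (n + 1) i →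
      |(i : ℝ) / (n + 1) - a| ≤ δ / 2 → dist z a < δ := fun i z a hz ha => by
    obtain ⟨hz1, hz2⟩ := hz
    push_cast at hz1 hz2
    rw [add_div] at hz2
    rw [abs_le] at ha
    rw [Subtype.dist_eq, Real.dist_eq, abs_lt]
    constructor <;> linarith
  have hcell : ∀ x : I, |(∫ z, f z ∂(volume[|cell (n + 1) (gapIndex u n x)
      (gapPerm u s n (gapIndex u n x))])) - f (x, phi u s x)| ≤ ε / 2 := fun x => by
    set i := gapIndex u n x
    have hp : IsProbabilityMeasure (volume[|cell (n + 1) i (gapPerm u s n i)]) :=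
      cond_isProbabilityMeasure (volume_cell_ne_zero i _)
    have := abs_integral_sub_le (μ := volume[|cell (n + 1) i (gapPerm u s n i)])
      (f.integrable _) (integrable_const (f (x, phi u s x))) (c := ε / 2) ?_
    · simpa using this
    · filter_upwards [ae_cond_mem ((measurableSet_gridInterval i).prod
        (measurableSet_gridInterval (gapPerm u s n i)))] with z hz
      exact (hfδ (max_lt (hgrid _ _ _ hz.1 (h1 x)) (hgrid _ _ _ hz.2 (h2 x)))).le
  have h4 : |(∫ z, f z ∂(permMeasure (gapPerm u s n))) - empAvg u n fun x => f (x, phi u s x)| ≤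
      ε / 2 := by
    have := abs_empAvg_sub_le u n hcell
    -- Each gap has exactly one left end point, so the sum over points is a reordered sum over
    -- columns.
    have hsum : ∑ j : Fin (n + 1), ∫ z, f z ∂(volume[|cell (n + 1) (gapIndex u n (gapPoint u j))
        (gapPerm u s n (gapIndex u n (gapPoint u j)))]) =
        ∑ i, ∫ z, f z ∂(volume[|cell (n + 1) i (gapPerm u s n i)]) :=
      Equiv.sum_comp (gapEquiv hu.injective hu.ne_zero n) fun i =>
        ∫ z, f z ∂(volume[|cell (n + 1) i (gapPerm u s n i)])
    rwa [empAvg, hsum, ← integral_permMeasure _ f.continuous] at this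
  rw [Real.dist_eq] at h3 ⊢
  rw [abs_le] at h4
  rw [abs_lt] at h3 ⊢
  constructor <;> linarith

theorem Equidistributed.isPermuton_muRec {u : ℕ → I} (hu : Equidistributed u) (s : ℕ → Bool) :
    IsPermuton (muRec u s) :=
  .of_tendsto (fun _ => isPermuton_permPermuton _) (hu.tendsto_gapPerm s)

theorem Equidistributed.measurePreserving_phi {u : ℕ → I} (hu : Equidistributed u)
    (s : ℕ → Bool) : MeasurePreserving (phi u s) volume volume := by
  refine ⟨measurable_phi u s, ?_⟩
  have h : ((volume : Measure I).map fun x => (x, phi u s x)).map Prod.snd = volume :=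
    (hu.isPermuton_muRec s).2
  rwa [Measure.map_map measurable_snd (measurable_graph_phi u s)] at h

/-! ### Independent uniform points are equidistributed -/

section Uniform

variable {Ω : Type*} [MeasurableSpace Ω] {p : ℝ} {P : Measure Ω}
  {U : ℕ → Ω → I} {S : ℕ → Ω → Bool}

theorem IsUniformSigned.ae_ne [IsProbabilityMeasure P] (h : IsUniformSigned p P U S) {i j : ℕ}
    (hij : i ≠ j) :
    ∀ᵐ ω ∂P, U i ω ≠ U j ω := by
  have h1 := (indepFun_iff_map_prod_eq_prod_map_map (h.measurable_U i).aemeasurable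
    (h.measurable_U j).aemeasurable).1 (h.indep_U.indepFun hij)
  rw [h.uniform_U, h.uniform_U] at h1
  have h2 : ∀ᵐ z : I × I ∂(P.map fun ω => (U i ω, U j ω)), z.1 ≠ z.2 := by
    rw [h1]
    refine (Measure.ae_prod_iff_ae_ae
      (measurableSet_eq_fun measurable_fst measurable_snd).compl).2 (.of_forall fun x => ?_)
    have : ∀ᵐ y : I, y ≠ x := by simp [ae_iff]
    filter_upwards [this] with y hy using hy.symm
  exact ae_of_ae_map ((h.measurable_U i).prodMk (h.measurable_U j)).aemeasurable h2

theorem IsUniformSigned.ae_injective [IsProbabilityMeasure P] (h : IsUniformSigned p P U S) :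
    ∀ᵐ ω ∂P, Function.Injective fun j => U j ω := by
  have : ∀ᵐ ω ∂P, ∀ i j, i ≠ j → U i ω ≠ U j ω :=
    ae_all_iff.2 fun i => ae_all_iff.2 fun j => by
      by_cases hij : i = j
      · simp [hij]
      · simpa [hij] using h.ae_ne hij
  filter_upwards [this] with ω hω i j hij
  by_contra hne
  exact hω i j hne hij

theorem IsUniformSigned.ae_ne_zero (h : IsUniformSigned p P U S) :
    ∀ᵐ ω ∂P, ∀ j, U j ω ≠ 0 := ae_all_iff.2 fun j => by
  refine ae_of_ae_map (p := fun x => x ≠ 0) (h.measurable_U j).aemeasurable ?_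
  rw [h.uniform_U]
  simp [ae_iff]

theorem IsUniformSigned.ae_tendsto_empAvg [IsProbabilityMeasure P] (h : IsUniformSigned p P U S)
    (a : I) : ∀ᵐ ω ∂P, Tendsto (fun n => empAvg (fun j => U j ω) n ((Set.Iic a).indicator 1)) atTop
      (𝓝 (a : ℝ)) := by
  have hm : Measurable ((Set.Iic a).indicator (1 : I → ℝ)) :=
    measurable_one.indicator measurableSet_Iic
  have hi : Integrable ((Set.Iic a).indicator (1 : I → ℝ)) volume :=
    (integrable_const (1 : ℝ)).indicator measurableSet_Iic
  have hid : ∀ j, IdentDistrib (U j) (U 0) P P := fun j =>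
    ⟨(h.measurable_U j).aemeasurable, (h.measurable_U 0).aemeasurable, by
      rw [h.uniform_U, h.uniform_U]⟩
  have h0 : ∫ ω, (Set.Iic a).indicator (1 : I → ℝ) (U 0 ω) ∂P = a := by
    rw [← integral_map (h.measurable_U 0).aemeasurable hm.aestronglyMeasurable, h.uniform_U,
      integral_indicator_one measurableSet_Iic, volume_real_Iic]
  have hL := strong_law_ae_real (μ := P) (fun j ω => (Set.Iic a).indicator (1 : I → ℝ) (U j ω))
    (by
      rw [← h.uniform_U 0] at hi
      exact hi.comp_measurable (h.measurable_U 0))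
    (fun i j hij => (h.indep_U.indepFun hij).comp hm hm)
    (fun j => (hid j).comp hm)
  filter_upwards [hL] with ω hω
  rw [h0] at hω
  -- The strong law averages `n` points over `n`; `empAvg` divides by `n + 1` and has the extra
  -- point `0`, which contributes `1 / (n + 1)`.
  have h1 := (hω.mul (tendsto_natCast_div_add_atTop (1 : ℝ))).add
    tendsto_one_div_add_atTop_nhds_zero_nat
  rw [mul_one, add_zero] at h1
  refine h1.congr fun n => ?_
  have h2 : (Set.Iic a).indicator (1 : I → ℝ) 0 = 1 := by
    simp
  rw [empAvg, Fin.sum_univ_succ, ← Fin.sum_univ_eq_sum_range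
    (fun j => (Set.Iic a).indicator (1 : I → ℝ) (U j ω))]
  simp only [gapPoint, Fin.val_zero, Fin.val_succ, h2]
  rcases n.eq_zero_or_pos with rfl | hn
  · simp
  · have hn' : (n : ℝ) ≠ 0 := by positivity
    field_simp
    ring

theorem IsUniformSigned.ae_equidistributed [IsProbabilityMeasure P]
    (h : IsUniformSigned p P U S) : ∀ᵐ ω ∂P, Equidistributed fun j => U j ω := by
  filter_upwards [h.ae_injective, h.ae_ne_zero,
    ae_all_iff.2 fun k => h.ae_tendsto_empAvg (TopologicalSpace.denseSeq I k)] with ω h1 h2 h3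
  exact ⟨h1, h2, h3⟩

end Uniform

/-! ### Sequential ranks -/

/-- The rank of `w k` among `w 0, …, w k`, counted from `0`. -/
def seqRank {α : Type*} [LinearOrder α] {n : ℕ} (w : Fin n → α) (k : Fin n) : Fin ((k : ℕ) + 1) :=
  ⟨((Finset.Iio k).filter fun j => w j ≤ w k).card, by
    have := Finset.card_filter_le (Finset.Iio k) fun j => w j ≤ w k
    rw [Fin.card_Iio] at this
    omega⟩

theorem seqRank_val {α : Type*} [LinearOrder α] {n : ℕ} (w : Fin n → α) (k : Fin n) :
    (seqRank w k : ℕ) = ((Finset.Iio k).filter fun j => w j ≤ w k).card := rfl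

theorem gapIndex_eq_seqRank (u : ℕ → I) {n : ℕ} (k : Fin n) :
    gapIndex u k (u k) = seqRank (fun j : Fin n => u j) k := by
  ext
  rw [gapIndex_val, seqRank_val, ← Finset.card_map Fin.valEmbedding, ← Nat.Iio_eq_range,
    ← Fin.map_valEmbedding_Iio, Finset.filter_map]
  rfl

theorem seqRank_congr {α β : Type*} [LinearOrder α] [LinearOrder β] {n : ℕ} {w : Fin n → α}
    {w' : Fin n → β} (h : ∀ i j, w i ≤ w j ↔ w' i ≤ w' j) : seqRank w = seqRank w' := by
  funext k
  ext
  simp only [seqRank_val, h]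

/-- Sequential ranks determine the relative order. -/
theorem le_iff_le_of_seqRank_eq {α β : Type*} [LinearOrder α] [LinearOrder β] {n : ℕ}
    {w : Fin n → α} {w' : Fin n → β} (hw : Function.Injective w) (hw' : Function.Injective w')
    (h : seqRank w = seqRank w') (i j : Fin n) : w i ≤ w j ↔ w' i ≤ w' j := by
  suffices H : ∀ m : ℕ, ∀ i j : Fin n, (i : ℕ) < m → (j : ℕ) < m → (w i ≤ w j ↔ w' i ≤ w' j) from
    H n i j i.2 j.2
  intro m
  induction m with
  | zero => exact fun i j hi => absurd hi (Nat.not_lt_zero _)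
  | succ m ih =>
    have key : ∀ i k : Fin n, (k : ℕ) = m → i < k → (w i ≤ w k ↔ w' i ≤ w' k) := by
      intro i k hk hi
      have hcard : ((Finset.Iio k).filter fun j => w j ≤ w k).card =
          ((Finset.Iio k).filter fun j => w' j ≤ w' k).card :=
        congrArg (fun r : (k : Fin n) → Fin ((k : ℕ) + 1) => (r k : ℕ)) h
      have heq : (Finset.Iio k).filter (fun j => w j ≤ w k) =
          (Finset.Iio k).filter fun j => w' j ≤ w' k := by
        -- By induction `w` and `w'` order the earlier indices alike, so both sets are initial
        -- segments of one order: they are nested, and equal cardinality makes them equal.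
        by_cases hsub : (Finset.Iio k).filter (fun j => w j ≤ w k) ⊆
            (Finset.Iio k).filter fun j => w' j ≤ w' k
        · exact Finset.eq_of_subset_of_card_le hsub hcard.ge
        · refine (Finset.eq_of_subset_of_card_le (fun b hb => ?_) hcard.le).symm
          obtain ⟨a, ha, ha'⟩ := Finset.not_subset.1 hsub
          simp only [Finset.mem_filter, Finset.mem_Iio, not_and, not_le] at ha ha' hb ⊢
          refine ⟨hb.1, le_trans ?_ ha.2⟩
          refine (ih b a (hk ▸ hb.1) (hk ▸ ha.1)).2 (hb.2.trans (ha' ha.1).le)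
      have := Finset.ext_iff.1 heq i
      simpa [hi] using this
    intro i j hi hj
    rcases lt_trichotomy i j with hij | rfl | hij
    · rcases (Nat.lt_succ_iff_lt_or_eq.1 hj) with hj' | hj'
      · exact ih i j (lt_trans hij hj') hj'
      · exact key i j hj' hij
    · simp
    · rcases (Nat.lt_succ_iff_lt_or_eq.1 hi) with hi' | hi'
      · exact ih i j hi' (lt_trans hij hi')
      · rw [← not_iff_not, not_le, not_le, lt_iff_le_and_ne, lt_iff_le_and_ne,
          key j i hi' hij]
        simp [hw.ne hij.ne, hw'.ne hij.ne]

/-- Sequential ranks determine the order, which gives injectivity, and both sides have `n!`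
elements. -/
theorem seqRank_perm_bijective (n : ℕ) : Function.Bijective
    fun ρ : Equiv.Perm (Fin n) => (seqRank ρ : (k : Fin n) → Fin ((k : ℕ) + 1)) := by
  refine (Fintype.bijective_iff_injective_and_card _).2 ⟨fun ρ τ h => ?_, ?_⟩
  · have h1 := le_iff_le_of_seqRank_eq ρ.injective τ.injective h
    have h2 : ρ⁻¹.trans τ = 1 := perm_eq_one_of_strictMono fun i j hij => by
      refine not_le.1 fun hle => hij.not_ge ?_
      simpa using (h1 (ρ⁻¹ j) (ρ⁻¹ i)).2 hle
    ext i
    have := congrArg (fun θ : Equiv.Perm (Fin n) => (θ (ρ i) : ℕ)) h2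
    simpa using this.symm
  · rw [Fintype.card_perm, Fintype.card_fin, Fintype.card_pi]
    simp only [Fintype.card_fin]
    rw [Fin.prod_univ_eq_prod_range (fun k => k + 1), Finset.prod_range_add_one_eq_factorial]

instance (n : ℕ) : MeasurableSpace (Equiv.Perm (Fin n)) := ⊤

instance (n : ℕ) : DiscreteMeasurableSpace (Equiv.Perm (Fin n)) := ⟨fun _ => trivial⟩

section Realization

variable {Ω : Type*} [MeasurableSpace Ω] {p : ℝ} {P : Measure Ω}
  {U : ℕ → Ω → I} {S : ℕ → Ω → Bool}

/-- Independent uniform points are in every relative order with the same probability. -/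
theorem IsUniformSigned.measureReal_strictMono [IsProbabilityMeasure P]
    (h : IsUniformSigned p P U S) {n : ℕ} (ρ : Equiv.Perm (Fin n)) :
    P.real {ω | StrictMono fun i => U (ρ i) ω} = (n.factorial : ℝ)⁻¹ := by
  have hms : MeasurableSet {v : Fin n → I | StrictMono v} := by
    have : {v : Fin n → I | StrictMono v} = ⋂ i, ⋂ j, {v | i < j → v i < v j} := by
      ext v
      simp [StrictMono]
    rw [this]
    refine MeasurableSet.iInter fun i => MeasurableSet.iInter fun j => ?_
    by_cases hij : i < j
    · simpa [hij] using measurableSet_lt (measurable_pi_apply i) (measurable_pi_apply j)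
    · simp [hij]
  have hmU : ∀ τ : Equiv.Perm (Fin n), Measurable fun ω i => U (τ i) ω := fun τ =>
    measurable_pi_iff.2 fun i => h.measurable_U _
  -- The law of i.i.d. points is invariant under reordering. The `n!` events are thus equiprobable;
  -- they are disjoint and cover almost everything.
  have hlaw : ∀ τ : Equiv.Perm (Fin n),
      P.real {ω | StrictMono fun i => U (τ i) ω} =
        (Measure.pi fun _ : Fin n => (volume : Measure I)).real {v | StrictMono v} := fun τ => by
    have hind : iIndepFun (fun i : Fin n => U (τ i)) P :=
      h.indep_U.precomp (Fin.val_injective.comp τ.injective)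
    have hmap := hind.map_fun_eq_pi_map fun i => (h.measurable_U _).aemeasurable
    simp only [h.uniform_U] at hmap
    rw [← hmap, map_measureReal_apply (hmU τ) hms]
    rfl
  have hdisj : Pairwise (Function.onFun Disjoint fun τ : Equiv.Perm (Fin n) =>
      {ω | StrictMono fun i => U (τ i) ω}) := fun τ τ' hne => by
    refine Set.disjoint_left.2 fun ω h1 h2 => hne ?_
    have h3 : τ.trans τ'.symm = 1 := perm_eq_one_of_strictMono fun i j hij => by
      refine h2.lt_iff_lt.1 ?_
      simpa using h1 hij
    ext i
    have h4 := congrArg (fun θ : Equiv.Perm (Fin n) => (τ' (θ i) : ℕ)) h3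
    simpa using h4
  have hunion : P.real (⋃ τ : Equiv.Perm (Fin n), {ω | StrictMono fun i => U (τ i) ω}) = 1 := by
    have : ∀ᵐ ω ∂P, ω ∈ ⋃ τ : Equiv.Perm (Fin n), {ω | StrictMono fun i => U (τ i) ω} := by
      filter_upwards [h.ae_injective] with ω hω
      refine Set.mem_iUnion.2 ⟨Tuple.sort fun i : Fin n => U i ω, ?_⟩
      exact (Tuple.monotone_sort fun i : Fin n => U i ω).strictMono_of_injective
        ((hω.comp Fin.val_injective).comp (Tuple.sort fun i : Fin n => U i ω).injective)
    have h1 := measure_congr (eventuallyEq_univ.2 this)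
    exact (congrArg ENNReal.toReal h1).trans (by simp)
  rw [measureReal_iUnion_fintype hdisj fun τ => hmU τ hms] at hunion
  simp only [hlaw] at hunion ⊢
  rw [Finset.sum_const, Finset.card_univ, Fintype.card_perm, Fintype.card_fin, nsmul_eq_mul]
    at hunion
  exact eq_inv_of_mul_eq_one_right hunion

/-- The sequential ranks of independent uniform points are independent and uniform. -/
theorem IsUniformSigned.measureReal_gapIndex [IsProbabilityMeasure P]
    (h : IsUniformSigned p P U S) (r : (n : ℕ) → Fin (n + 1)) (n : ℕ) :
    P.real {ω | ∀ k < n, gapIndex (fun j => U j ω) k (U k ω) = r k} = (n.factorial : ℝ)⁻¹ := by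
  -- Prescribing all the ranks amounts almost surely to prescribing the relative order, encoded by
  -- `ρ`.
  obtain ⟨ρ, hρ⟩ := (seqRank_perm_bijective n).surjective fun k => r k
  rw [← h.measureReal_strictMono ρ.symm]
  refine measureReal_congr ?_
  filter_upwards [h.ae_injective] with ω hω
  refine propext ?_
  change (∀ k < n, gapIndex (fun j => U j ω) k (U k ω) = r k) ↔
    StrictMono fun i => U (ρ.symm i) ω
  have h1 : (∀ k < n, gapIndex (fun j => U j ω) k (U k ω) = r k) ↔
      seqRank (fun j : Fin n => U j ω) = seqRank ρ := by
    rw [show seqRank ρ = fun k : Fin n => r k from hρ, funext_iff]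
    exact ⟨fun H k => (gapIndex_eq_seqRank (fun j => U j ω) k).symm.trans (H k k.2),
      fun H k hk => (gapIndex_eq_seqRank (fun j => U j ω) ⟨k, hk⟩).trans (H ⟨k, hk⟩)⟩
  rw [h1]
  constructor
  · intro H i j hij
    have h2 := le_iff_le_of_seqRank_eq (hω.comp Fin.val_injective) ρ.injective H (ρ.symm j)
      (ρ.symm i)
    rw [Equiv.apply_symm_apply, Equiv.apply_symm_apply] at h2
    exact not_le.1 fun hle => hij.not_ge (h2.1 hle)
  · intro H
    refine seqRank_congr fun i j => ?_
    simpa using H.le_iff_le (a := ρ i) (b := ρ j)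

/-- The probability of a sign. -/
def signProb (p : ℝ) (b : Bool) : ℝ := if b then p else 1 - p

theorem IsUniformSigned.measureReal_sign [IsProbabilityMeasure P] (h : IsUniformSigned p P U S)
    (k : ℕ) (b : Bool) : P.real {ω | S k ω = b} = signProb p b := by
  cases b
  · have : {ω | S k ω = false} = {ω | S k ω = true}ᶜ := by
      ext ω
      simp
    have hm : MeasurableSet {ω | S k ω = true} := h.measurable_S k (measurableSet_singleton true)
    rw [this, probReal_compl_eq_one_sub hm, h.sign_S]
    simp [signProb]
  · simpa [signProb] using h.sign_S k

theorem IsUniformSigned.measureReal_signs [IsProbabilityMeasure P] (h : IsUniformSigned p P U S)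
    (s : ℕ → Bool) (n : ℕ) :
    P.real {ω | ∀ k < n, S k ω = s k} = ∏ k ∈ Finset.range n, signProb p (s k) := by
  have h1 := h.indep_S.measure_inter_preimage_eq_mul (Finset.range n) (sets := fun k => {s k})
    fun k _ => measurableSet_singleton _
  have h2 : {ω | ∀ k < n, S k ω = s k} = ⋂ k ∈ Finset.range n, S k ⁻¹' {s k} := by
    ext ω
    simp
  rw [h2, measureReal_def, h1, ENNReal.toReal_prod]
  exact Finset.prod_congr rfl fun k _ => h.measureReal_sign k (s k)

theorem measurable_gapIndex_self (n : ℕ) : Measurable fun u : ℕ → I => gapIndex u n (u n) := by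
  classical
  have h : Measurable fun u : ℕ → I => (gapIndex u n (u n) : ℕ) := by
    have : (fun u : ℕ → I => (gapIndex u n (u n) : ℕ)) =
        fun u => ∑ j ∈ Finset.range n, if u j ≤ u n then 1 else 0 := by
      ext u
      rw [gapIndex_val, Finset.card_filter]
    rw [this]
    exact Finset.measurable_sum _ fun j _ => Measurable.ite
      (measurableSet_le (measurable_pi_apply j) (measurable_pi_apply n))
      measurable_const measurable_const
  refine measurable_to_countable' fun i => ?_
  have : (fun u : ℕ → I => gapIndex u n (u n)) ⁻¹' {i} =
      (fun u : ℕ → I => (gapIndex u n (u n) : ℕ)) ⁻¹' {(i : ℕ)} := by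
    ext u
    simp [Fin.ext_iff]
  rw [this]
  exact h (measurableSet_singleton _)

theorem IsUniformSigned.measurable_rank (h : IsUniformSigned p P U S) (n : ℕ) :
    Measurable fun ω => gapIndex (fun j => U j ω) n (U n ω) :=
  (measurable_gapIndex_self n).comp (measurable_pi_iff.2 h.measurable_U)

theorem IsUniformSigned.measureReal_rank_sign [IsProbabilityMeasure P]
    (h : IsUniformSigned p P U S) (r : (n : ℕ) → Fin (n + 1)) (s : ℕ → Bool) (n : ℕ) :
    P.real {ω | ∀ k < n, gapIndex (fun j => U j ω) k (U k ω) = r k ∧ S k ω = s k} =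
      (n.factorial : ℝ)⁻¹ * ∏ k ∈ Finset.range n, signProb p (s k) := by
  rw [← h.measureReal_gapIndex r n, ← h.measureReal_signs s n]
  have hA : MeasurableSet {u : ℕ → I | ∀ k < n, gapIndex u k (u k) = r k} := by
    have : {u : ℕ → I | ∀ k < n, gapIndex u k (u k) = r k} =
        ⋂ k, ⋂ _ : k < n, (fun u => gapIndex u k (u k)) ⁻¹' {r k} := by
      ext
      simp
    rw [this]
    exact .iInter fun k => .iInter fun _ => measurable_gapIndex_self k (measurableSet_singleton _)
  have hB : MeasurableSet {v : ℕ → Bool | ∀ k < n, v k = s k} := by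
    have : {v : ℕ → Bool | ∀ k < n, v k = s k} =
        ⋂ k, ⋂ _ : k < n, (fun v : ℕ → Bool => v k) ⁻¹' {s k} := by
      ext
      simp
    rw [this]
    exact .iInter fun k => .iInter fun _ => measurable_pi_apply k (measurableSet_singleton _)
  have h1 := h.indep.measure_inter_preimage_eq_mul _ _ hA hB
  rw [measureReal_def, measureReal_def, measureReal_def, ← ENNReal.toReal_mul]
  refine congrArg ENNReal.toReal (Eq.trans (congrArg P ?_) h1)
  ext ω
  exact forall₂_and

theorem inflations_congr {r r' : (n : ℕ) → Fin (n + 1)} {s s' : ℕ → Bool} {m n : ℕ}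
    (h : ∀ k < n, r k = r' k ∧ s k = s' k) (hm : m ≤ n) :
    inflations r s m = inflations r' s' m := by
  induction m with
  | zero => rfl
  | succ m ih => rw [inflations, inflations, ih (by omega), (h m hm).1, (h m hm).2]

theorem gapPerm_succ (u : ℕ → I) (s : ℕ → Bool) (n : ℕ) : gapPerm u s (n + 1) =
    inflate (gapPerm u s n) (gapPerm u s n (gapIndex u n (u n))) (s n) := rfl

theorem IsUniformSigned.measurable_gapPerm (h : IsUniformSigned p P U S) (n : ℕ) :
    Measurable fun ω => gapPerm (fun j => U j ω) (fun j => S j ω) n := by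
  induction n with
  | zero => exact measurable_const
  | succ n ih =>
    let g : (Equiv.Perm (Fin (n + 1)) × Fin (n + 1)) × Bool → Equiv.Perm (Fin (n + 2)) :=
      fun x => inflate x.1.1 (x.1.1 x.1.2) x.2
    have hg : Measurable g := measurable_of_countable _
    have h2 : Measurable fun ω => ((gapPerm (fun j => U j ω) (fun j => S j ω) n,
        gapIndex (fun j => U j ω) n (U n ω)), S n ω) :=
      (ih.prodMk (h.measurable_rank n)).prodMk (h.measurable_S n)
    have h3 : (fun ω => gapPerm (fun j => U j ω) (fun j => S j ω) (n + 1)) = g ∘ fun ω =>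
        ((gapPerm (fun j => U j ω) (fun j => S j ω) n,
        gapIndex (fun j => U j ω) n (U n ω)), S n ω) := by
      funext ω
      exact gapPerm_succ _ _ _
    rw [h3]
    exact hg.comp h2

theorem IsUniformSigned.measurableSet_past (h : IsUniformSigned p P U S)
    (π : (k : ℕ) → Equiv.Perm (Fin (k + 1))) (n : ℕ) :
    MeasurableSet {ω | ∀ k ≤ n, gapPerm (fun j => U j ω) (fun j => S j ω) k = π k} := by
  have : {ω | ∀ k ≤ n, gapPerm (fun j => U j ω) (fun j => S j ω) k = π k} =
      ⋂ k, ⋂ _ : k ≤ n, (fun ω => gapPerm (fun j => U j ω) (fun j => S j ω) k) ⁻¹' {π k} := by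
    ext
    simp
  rw [this]
  exact .iInter fun k => .iInter fun _ => h.measurable_gapPerm k trivial

/-- The next rank and sign are independent of the permutations built so far. -/
theorem IsUniformSigned.measureReal_past_inter [IsProbabilityMeasure P]
    (h : IsUniformSigned p P U S) (π : (k : ℕ) → Equiv.Perm (Fin (k + 1))) (n : ℕ)
    (i : Fin (n + 1)) (b : Bool) :
    P.real ({ω | ∀ k ≤ n, gapPerm (fun j => U j ω) (fun j => S j ω) k = π k} ∩
      {ω | gapIndex (fun j => U j ω) n (U n ω) = i ∧ S n ω = b}) =
    P.real {ω | ∀ k ≤ n, gapPerm (fun j => U j ω) (fun j => S j ω) k = π k} *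
      (1 / ((n + 1 : ℕ) : ℝ) * signProb p b) := by
  set A := {ω | ∀ k ≤ n, gapPerm (fun j => U j ω) (fun j => S j ω) k = π k} with hA
  set G := {ω | gapIndex (fun j => U j ω) n (U n ω) = i ∧ S n ω = b} with hG
  have hAm : MeasurableSet A := h.measurableSet_past π n
  have hGm : MeasurableSet G := (h.measurable_rank n (measurableSet_singleton i)).inter
    (h.measurable_S n (measurableSet_singleton b))
  -- The past permutations are functions of the first `n` ranks and signs, so each atom of `Z` lies
  -- in `A` or misses it, and the identity can be checked atom by atom.
  let Z : Ω → (k : Fin n) → Fin ((k : ℕ) + 1) × Bool := fun ω k =>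
    (gapIndex (fun j => U j ω) k (U k ω), S k ω)
  have hZ : Measurable Z := measurable_pi_iff.2 fun k =>
    (h.measurable_rank k).prodMk (h.measurable_S k)
  have hsum : ∀ B, MeasurableSet B → P.real B = ∑ z, P.real (B ∩ Z ⁻¹' {z}) := fun B hB => by
    have := sum_measureReal_preimage_singleton (μ := P.restrict B) Finset.univ (f := Z)
      fun z _ => hZ (measurableSet_singleton z)
    simp only [Finset.coe_univ, Set.preimage_univ, measureReal_restrict_apply_univ] at this
    rw [← this]
    refine Finset.sum_congr rfl fun z _ => ?_
    rw [measureReal_restrict_apply (hZ (measurableSet_singleton z)), Set.inter_comm]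
  rw [hsum _ (hAm.inter hGm), hsum A hAm, Finset.sum_mul]
  refine Finset.sum_congr rfl fun z _ => ?_
  rcases (A ∩ Z ⁻¹' {z}).eq_empty_or_nonempty with he | ⟨ω₀, hω₀, hz⟩
  · rw [Set.inter_right_comm, he]
    simp
  set r : (k : ℕ) → Fin (k + 1) := fun k => gapIndex (fun j => U j ω₀) k (U k ω₀) with hr
  set s : ℕ → Bool := fun k => S k ω₀ with hs
  have hZz : Z ⁻¹' {z} =
      {ω | ∀ k < n, gapIndex (fun j => U j ω) k (U k ω) = r k ∧ S k ω = s k} := by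
    ext ω
    rw [Set.mem_preimage, ← show Z ω₀ = z from hz, Set.mem_singleton_iff, funext_iff]
    exact ⟨fun H k hk => Prod.ext_iff.1 (H ⟨k, hk⟩), fun H k => Prod.ext_iff.2 (H k k.2)⟩
  have hsub : Z ⁻¹' {z} ⊆ A := fun ω hω k hk => by
    rw [hZz] at hω
    exact (inflations_congr hω hk).trans (hω₀ k hk)
  -- Adding the next rank and sign gives an event of the same type at level `n + 1`; passing from
  -- `n!` to `(n + 1)!` yields the factor `1 / (n + 1)`.
  have hnext : Z ⁻¹' {z} ∩ G = {ω | ∀ k < n + 1, gapIndex (fun j => U j ω) k (U k ω) =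
      Function.update r n i k ∧ S k ω = Function.update s n b k} := by
    rw [hZz]
    ext ω
    simp only [Nat.forall_lt_succ_right, Function.update_self]
    refine and_congr_left fun _ => forall₂_congr fun k hk => ?_
    rw [Function.update_of_ne hk.ne, Function.update_of_ne hk.ne]
  rw [Set.inter_right_comm, Set.inter_eq_right.2 hsub, hnext, hZz, h.measureReal_rank_sign,
    h.measureReal_rank_sign, Finset.prod_range_succ, Function.update_self, Nat.factorial_succ]
  have : ∏ k ∈ Finset.range n, signProb p (Function.update s n b k) =
      ∏ k ∈ Finset.range n, signProb p (s k) := Finset.prod_congr rfl fun k hk => by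
    rw [Function.update_of_ne (Finset.mem_range.1 hk).ne]
  rw [this, Nat.cast_mul, mul_inv]
  ring

theorem IsUniformSigned.isRecursiveSeparable [IsProbabilityMeasure P]
    (h : IsUniformSigned p P U S) : IsRecursiveSeparable p P
      fun n ω => gapPerm (fun j => U j ω) (fun j => S j ω) n where
  measurable n τ := h.measurable_gapPerm n trivial
  step n π := by
    set A := {ω | ∀ k ≤ n, gapPerm (fun j => U j ω) (fun j => S j ω) k = π k} with hA
    have hAm : MeasurableSet A := h.measurableSet_past π n
    let Z : Ω → Fin (n + 1) × Bool := fun ω => (gapIndex (fun j => U j ω) n (U n ω), S n ω)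
    have hZ : Measurable Z := (h.measurable_rank n).prodMk (h.measurable_S n)
    set B := {ω | ∀ k ≤ n + 1, gapPerm (fun j => U j ω) (fun j => S j ω) k = π k} with hB
    have hBA : ∀ z, P.real (B ∩ Z ⁻¹' {z}) =
        if inflate (π n) (π n z.1) z.2 = π (n + 1) then P.real (A ∩ Z ⁻¹' {z}) else 0 := by
      intro z
      have hstep : ∀ ω ∈ A, ω ∈ Z ⁻¹' {z} →
          gapPerm (fun j => U j ω) (fun j => S j ω) (n + 1) = inflate (π n) (π n z.1) z.2 := by
        intro ω hω hz
        rw [← show Z ω = z from hz, ← hω n le_rfl]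
        rfl
      split_ifs with hπ
      · congr 1
        ext ω
        refine ⟨fun hω => ⟨fun k hk => hω.1 k (hk.trans n.le_succ), hω.2⟩,
          fun hω => ⟨fun k hk => ?_, hω.2⟩⟩
        rcases Nat.le_succ_iff_eq_or_le.1 hk with rfl | hk
        · exact (hstep ω hω.1 hω.2).trans hπ
        · exact hω.1 k hk
      · rw [measureReal_def, ENNReal.toReal_eq_zero_iff]
        left
        convert! measure_empty (μ := P)
        refine Set.eq_empty_of_forall_notMem fun ω hω => hπ ?_
        rw [← hstep ω (fun k hk => hω.1 k (hk.trans n.le_succ)) hω.2]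
        exact hω.1 (n + 1) le_rfl
    have hpast : ∀ z : Fin (n + 1) × Bool,
        P.real (A ∩ Z ⁻¹' {z}) = P.real A * (1 / ((n + 1 : ℕ) : ℝ) * signProb p z.2) := by
      rintro ⟨i, b⟩
      rw [← h.measureReal_past_inter π n i b]
      congr 2
      ext ω
      simp [Z]
    have hsum := sum_measureReal_preimage_singleton (μ := P.restrict B) Finset.univ (f := Z)
      fun z _ => hZ (measurableSet_singleton z)
    simp only [Finset.coe_univ, Set.preimage_univ, measureReal_restrict_apply_univ,
      measureReal_restrict_apply (hZ (measurableSet_singleton _))] at hsum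
    rw [← hsum]
    simp only [Set.inter_comm _ B, hBA, hpast]
    -- The model chooses a uniform value, the points a uniform position; the bijection `π n`
    -- exchanges the two.
    rw [stepProb, ← Equiv.sum_comp (π n), Finset.mul_sum, Fintype.sum_prod_type]
    refine Finset.sum_congr rfl fun i _ => ?_
    simp only [Fintype.sum_bool, signProb, Bool.false_eq_true, if_true, if_false]
    split_ifs <;> ring

end Realization

/-! ### The law of the chain on the space of paths -/

/-- The event that a sequence of permutations starts with `π 0, …, π n`. -/
def pathCylinder (n : ℕ) (π : (k : ℕ) → Equiv.Perm (Fin (k + 1))) :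
    Set ((k : ℕ) → Equiv.Perm (Fin (k + 1))) :=
  {x | ∀ k ≤ n, x k = π k}

theorem measurableSet_pathCylinder (n : ℕ) (π : (k : ℕ) → Equiv.Perm (Fin (k + 1))) :
    MeasurableSet (pathCylinder n π) := by
  have : pathCylinder n π = ⋂ k, ⋂ _ : k ≤ n, (fun x => x k) ⁻¹' {π k} := by
    ext
    simp [pathCylinder]
  rw [this]
  exact .iInter fun k => .iInter fun _ => measurable_pi_apply k (measurableSet_singleton _)

/-- Two cylinders with a common path `x` are both given by prefixes of `x`, so their intersection is
the one with the longer prefix. -/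
theorem isPiSystem_pathCylinder :
    IsPiSystem (Set.range fun x : ℕ × ((k : ℕ) → Equiv.Perm (Fin (k + 1))) =>
      pathCylinder x.1 x.2) := by
  rintro _ ⟨⟨m, π⟩, rfl⟩ _ ⟨⟨n, τ⟩, rfl⟩ ⟨x, hx, hx'⟩
  refine ⟨⟨max m n, x⟩, Set.ext fun y => ⟨fun hy => ⟨fun k hk => ?_, fun k hk => ?_⟩,
    fun hy k hk => ?_⟩⟩
  · exact (hy k (hk.trans (le_max_left _ _))).trans (hx k hk)
  · exact (hy k (hk.trans (le_max_right _ _))).trans (hx' k hk)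
  · rcases le_max_iff.1 hk with hk | hk
    · exact (hy.1 k hk).trans (hx k hk).symm
    · exact (hy.2 k hk).trans (hx' k hk).symm

theorem generateFrom_pathCylinder :
    (MeasurableSpace.pi : MeasurableSpace ((k : ℕ) → Equiv.Perm (Fin (k + 1)))) =
      .generateFrom (Set.range fun x : ℕ × ((k : ℕ) → Equiv.Perm (Fin (k + 1))) =>
        pathCylinder x.1 x.2) := by
  refine le_antisymm (iSup_le fun n => ?_) (MeasurableSpace.generateFrom_le ?_)
  · refine measurable_iff_comap_le.1 ?_
    refine @measurable_to_countable' _ _ _ _ (.generateFrom _) _ fun τ => ?_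
    -- A coordinate event is a finite union over prefixes ending in `τ`; the filler `1` beyond `n`
    -- plays no role.
    have : (fun x : (k : ℕ) → Equiv.Perm (Fin (k + 1)) => x n) ⁻¹' {τ} =
        ⋃ z : (k : Fin (n + 1)) → Equiv.Perm (Fin (k + 1)), ⋃ _ : z (Fin.last n) = τ,
          pathCylinder n fun k => if h : k < n + 1 then z ⟨k, h⟩ else 1 := by
      ext x
      simp only [Set.mem_preimage, Set.mem_singleton_iff, Set.mem_iUnion, exists_prop, pathCylinder,
        Set.mem_ofPred_eq]
      constructor
      · exact fun hx => ⟨fun k => x k, hx, fun k hk => by simp [Nat.lt_succ_of_le hk]⟩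
      · rintro ⟨z, rfl, hz⟩
        exact (hz n le_rfl).trans (dif_pos n.lt_succ_self)
    rw [this]
    exact .iUnion fun z => .iUnion fun _ => MeasurableSpace.measurableSet_generateFrom ⟨(n, _), rfl⟩
  · rintro _ ⟨x, rfl⟩
    exact measurableSet_pathCylinder _ _

section Law

variable {Ω Ω' : Type*} [MeasurableSpace Ω] [MeasurableSpace Ω'] {p : ℝ} {P : Measure Ω}
  {P' : Measure Ω'} {perm : (n : ℕ) → Ω → Equiv.Perm (Fin (n + 1))}
  {perm' : (n : ℕ) → Ω' → Equiv.Perm (Fin (n + 1))}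

theorem IsRecursiveSeparable.measurable_path (h : IsRecursiveSeparable p P perm) :
    Measurable fun ω n => perm n ω :=
  measurable_pi_iff.2 fun n => measurable_to_countable' (h.measurable n)

theorem IsRecursiveSeparable.measureReal_eq_prod [IsProbabilityMeasure P]
    (h : IsRecursiveSeparable p P perm) (n : ℕ) (π : (k : ℕ) → Equiv.Perm (Fin (k + 1))) :
    P.real {ω | ∀ k ≤ n, perm k ω = π k} =
      ∏ k ∈ Finset.range n, stepProb p (π k) (π (k + 1)) := by
  induction n with
  | zero =>
    have : {ω | ∀ k ≤ 0, perm k ω = π k} = Set.univ := Set.eq_univ_of_forall fun ω k hk => by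
      obtain rfl := Nat.le_zero.1 hk
      exact Subsingleton.elim (α := Equiv.Perm (Fin 1)) _ _
    rw [this]
    simp
  | succ n ih => rw [h.step, ih, Finset.prod_range_succ]

/-- The transition probabilities fix the measure of every cylinder, and cylinders form a generating
π-system. -/
theorem IsRecursiveSeparable.map_eq [IsProbabilityMeasure P] [IsProbabilityMeasure P']
    (h : IsRecursiveSeparable p P perm) (h' : IsRecursiveSeparable p P' perm') :
    P.map (fun ω n => perm n ω) = P'.map fun ω n => perm' n ω := by
  have := Measure.isProbabilityMeasure_map h.measurable_path.aemeasurable (μ := P)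
  have := Measure.isProbabilityMeasure_map h'.measurable_path.aemeasurable (μ := P')
  refine ext_of_generate_finite _ generateFrom_pathCylinder isPiSystem_pathCylinder ?_ (by simp)
  rintro _ ⟨⟨n, π⟩, rfl⟩
  rw [Measure.map_apply h.measurable_path (measurableSet_pathCylinder _ _),
    Measure.map_apply h'.measurable_path (measurableSet_pathCylinder _ _),
    ← ENNReal.toReal_eq_toReal_iff' (measure_ne_top _ _) (measure_ne_top _ _)]
  exact (h.measureReal_eq_prod n π).trans (h'.measureReal_eq_prod n π).symm

end Law

/-! ### The limit of a sequence of permutations -/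

theorem measurableSet_preimage_of_isOpen {X Y : Type*} [MeasurableSpace X] [TopologicalSpace Y]
    [TopologicalSpace.PseudoMetrizableSpace Y] {f : X → Y} (hf : StronglyMeasurable f) {V : Set Y}
    (hV : IsOpen V) : MeasurableSet (f ⁻¹' V) := by
  borelize Y
  exact hf.measurable hV.measurableSet

/-- Strong measurability for the weak topology implies measurability for the Giry `σ`-algebra. -/
theorem measurable_of_stronglyMeasurable {X E : Type*} [MeasurableSpace X] [TopologicalSpace E]
    [MeasurableSpace E] [BorelSpace E] [HasOuterApproxClosed E]
    [TopologicalSpace.PseudoMetrizableSpace (ProbabilityMeasure E)]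
    {f : X → ProbabilityMeasure E} (hf : StronglyMeasurable f) : Measurable f := by
  have hprob : ∀ x, IsProbabilityMeasure (f x : Measure E) := fun x => (f x).2
  have key : Measurable fun x => (f x : Measure E) := by
    refine Measurable.measure_of_isPiSystem_of_isProbabilityMeasure
      (BorelSpace.measurable_eq (α := E)) isPiSystem_isOpen fun G (hG : IsOpen G) => ?_
    refine measurable_of_Ioi fun a => ?_
    -- By the portmanteau theorem, the mass of an open set is lower semicontinuous for weak
    -- convergence.
    have hopen : IsOpen {μ : ProbabilityMeasure E | a < (μ : Measure E) G} := by
      have : LowerSemicontinuous fun μ : ProbabilityMeasure E => (μ : Measure E) G :=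
        lowerSemicontinuous_iff_le_liminf.2 fun μ =>
          ProbabilityMeasure.le_liminf_measure_open_of_tendsto tendsto_id hG
      exact this.isOpen_preimage a
    exact measurableSet_preimage_of_isOpen hf hopen
  exact key.subtype_mk

instance : TopologicalSpace.IsCompletelyMetrizableSpace (ProbabilityMeasure (I × I)) := by
  let _ := TopologicalSpace.metrizableSpaceMetric (ProbabilityMeasure (I × I))
  infer_instance

instance : Nonempty (ProbabilityMeasure (I × I)) := ⟨permPermuton (1 : Equiv.Perm (Fin 1))⟩

open scoped Classical in
/-- The limit of a sequence of permutations (some fixed permuton if the sequence diverges). -/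
def limitPermuton (x : (n : ℕ) → Equiv.Perm (Fin (n + 1))) : ProbabilityMeasure (I × I) :=
  if ∃ μ, Tendsto (fun n => permPermuton (x n)) atTop (𝓝 μ) then
    limUnder atTop fun n => permPermuton (x n)
  else permPermuton (1 : Equiv.Perm (Fin 1))

theorem limitPermuton_eq {x : (n : ℕ) → Equiv.Perm (Fin (n + 1))}
    {μ : ProbabilityMeasure (I × I)} (h : Tendsto (fun n => permPermuton (x n)) atTop (𝓝 μ)) :
    limitPermuton x = μ := by
  rw [limitPermuton, if_pos ⟨μ, h⟩, h.limUnder_eq]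

theorem isPermuton_limitPermuton (x : (n : ℕ) → Equiv.Perm (Fin (n + 1))) :
    IsPermuton (limitPermuton x) := by
  by_cases h : ∃ μ, Tendsto (fun n => permPermuton (x n)) atTop (𝓝 μ)
  · obtain ⟨μ, hμ⟩ := h
    rw [limitPermuton_eq hμ]
    exact .of_tendsto (fun n => isPermuton_permPermuton _) hμ
  · rw [limitPermuton, if_neg h]
    exact isPermuton_permPermuton _

theorem stronglyMeasurable_permPermuton (n : ℕ) :
    StronglyMeasurable fun x : (n : ℕ) → Equiv.Perm (Fin (n + 1)) => permPermuton (x n) :=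
  (StronglyMeasurable.of_discrete (f := fun π : Equiv.Perm (Fin (n + 1)) =>
    permPermuton π)).comp_measurable (measurable_pi_apply n)

theorem measurableSet_exists_tendsto_permPermuton :
    MeasurableSet {x : (n : ℕ) → Equiv.Perm (Fin (n + 1)) |
      ∃ μ, Tendsto (fun n => permPermuton (x n)) atTop (𝓝 μ)} :=
  StronglyMeasurable.measurableSet_exists_tendsto stronglyMeasurable_permPermuton

theorem measurable_limitPermuton : Measurable limitPermuton :=
  measurable_of_stronglyMeasurable (StronglyMeasurable.ite measurableSet_exists_tendsto_permPermuton
    (StronglyMeasurable.limUnder stronglyMeasurable_permPermuton) stronglyMeasurable_const)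

/-! ### Existence of the points and signs -/

/-- Provides one realization to compare with, so that convergence of the chain on any space needs no
given points. -/
theorem exists_isUniformSigned {p : ℝ} (hp : p ∈ Set.Icc (0 : ℝ) 1) :
    ∃ (Ω : Type) (_ : MeasurableSpace Ω) (P : Measure Ω) (U : ℕ → Ω → I) (S : ℕ → Ω → Bool),
      IsProbabilityMeasure P ∧ IsUniformSigned p P U S := by
  let ν : Measure Bool :=
    ENNReal.ofReal p • Measure.dirac true + ENNReal.ofReal (1 - p) • Measure.dirac false
  have hν : IsProbabilityMeasure ν := ⟨by
    simp [ν, ← ENNReal.ofReal_add hp.1 (sub_nonneg.2 hp.2)]⟩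
  let A : Measure (ℕ → I) := Measure.infinitePi fun _ => volume
  let B : Measure (ℕ → Bool) := Measure.infinitePi fun _ => ν
  have hA : ∀ j, (A.prod B).map (fun ω => ω.1 j) = volume := fun j => by
    have h1 := Measure.map_map (μ := A.prod B) (measurable_pi_apply j) measurable_fst
    rw [Measure.map_fst_prod, measure_univ, one_smul, Measure.infinitePi_map_eval] at h1
    exact h1.symm
  have hB : ∀ j, (A.prod B).map (fun ω => ω.2 j) = ν := fun j => by
    have h1 := Measure.map_map (μ := A.prod B) (measurable_pi_apply j) measurable_snd
    rw [Measure.map_snd_prod, measure_univ, one_smul, Measure.infinitePi_map_eval] at h1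
    exact h1.symm
  refine ⟨(ℕ → I) × (ℕ → Bool), inferInstance, A.prod B, fun j ω => ω.1 j, fun j ω => ω.2 j,
    inferInstance, fun j => by fun_prop, fun j => by fun_prop, hA, fun j => ?_, ?_, ?_, ?_⟩
  · have h1 : (A.prod B).real {ω | ω.2 j = true} = ν.real {true} := by
      rw [← hB j, map_measureReal_apply (by fun_prop) (measurableSet_singleton _)]
      rfl
    rw [h1]
    simp [ν, measureReal_def, hp.1]
  · rw [iIndepFun_iff_map_fun_eq_infinitePi_map fun j => by fun_prop]
    simp only [hA]
    exact (Measure.map_fst_prod).trans (by simp [A])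
  · rw [iIndepFun_iff_map_fun_eq_infinitePi_map fun j => by fun_prop]
    simp only [hB]
    exact (Measure.map_snd_prod).trans (by simp [B])
  · exact indepFun_prod measurable_id measurable_id

/-! ### Convergence -/

theorem IsUniformSigned.ae_tendsto_gapPerm {Ω : Type*} [MeasurableSpace Ω] {p : ℝ} {P : Measure Ω}
    [IsProbabilityMeasure P] {U : ℕ → Ω → I} {S : ℕ → Ω → Bool} (h : IsUniformSigned p P U S) :
    ∀ᵐ ω ∂P, Tendsto (fun n => permPermuton (gapPerm (fun j => U j ω) (fun j => S j ω) n)) atTop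
      (𝓝 (muRec (fun j => U j ω) fun j => S j ω)) := by
  filter_upwards [h.ae_equidistributed] with ω hω using hω.tendsto_gapPerm _

/-- Convergence is a measurable event in path space, so its probability depends only on the law of
the path, and it has probability one for `gapPerm`. -/
theorem IsRecursiveSeparable.ae_tendsto {Ω : Type*} [MeasurableSpace Ω] {p : ℝ} {P : Measure Ω}
    [IsProbabilityMeasure P] {perm : (n : ℕ) → Ω → Equiv.Perm (Fin (n + 1))}
    (hp : p ∈ Set.Icc (0 : ℝ) 1) (h : IsRecursiveSeparable p P perm) :
    ∀ᵐ ω ∂P, Tendsto (fun n => permPermuton (perm n ω)) atTop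
      (𝓝 (limitPermuton fun n => perm n ω)) := by
  obtain ⟨Ω', _, P', U, S, _, hUS⟩ := exists_isUniformSigned hp
  have h1 : ∀ᵐ x ∂(P'.map fun ω n => gapPerm (fun j => U j ω) (fun j => S j ω) n),
      ∃ μ, Tendsto (fun n => permPermuton (x n)) atTop (𝓝 μ) := by
    rw [ae_map_iff hUS.isRecursiveSeparable.measurable_path.aemeasurable
      measurableSet_exists_tendsto_permPermuton]
    filter_upwards [hUS.ae_tendsto_gapPerm] with ω hω using ⟨_, hω⟩
  rw [← h.map_eq hUS.isRecursiveSeparable] at h1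
  filter_upwards [ae_of_ae_map h.measurable_path.aemeasurable h1] with ω ⟨μ, hμ⟩
  rwa [limitPermuton_eq hμ]

/-- The limit is one measurable function of the path, applied to two paths of equal law; along
`gapPerm` it is almost surely `muRec`. -/
theorem IsRecursiveSeparable.identDistrib {Ω Ω' : Type*} [MeasurableSpace Ω] [MeasurableSpace Ω']
    {p : ℝ} {P : Measure Ω} {P' : Measure Ω'} [IsProbabilityMeasure P] [IsProbabilityMeasure P']
    {perm : (n : ℕ) → Ω → Equiv.Perm (Fin (n + 1))} (h : IsRecursiveSeparable p P perm)
    {U : ℕ → Ω' → I} {S : ℕ → Ω' → Bool} (hUS : IsUniformSigned p P' U S) :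
    IdentDistrib (fun ω => limitPermuton fun n => perm n ω)
      (fun ω => muRec (fun j => U j ω) (fun j => S j ω)) P P' := by
  have h' := hUS.isRecursiveSeparable
  have h1 : IdentDistrib (fun ω n => perm n ω)
      (fun ω n => gapPerm (fun j => U j ω) (fun j => S j ω) n) P P' :=
    ⟨h.measurable_path.aemeasurable, h'.measurable_path.aemeasurable, h.map_eq h'⟩
  have h2 := h1.comp measurable_limitPermuton
  refine h2.trans (.of_ae_eq h2.aemeasurable_snd ?_)
  filter_upwards [hUS.ae_tendsto_gapPerm] with ω hω using limitPermuton_eq hω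

end RecSep
end

theorem theorem1p1 (p : ℝ) (hp : p ∈ Set.Ioo (0 : ℝ) 1) :
    (∀ (Ω : Type*) [MeasurableSpace Ω] (P : Measure Ω) [IsProbabilityMeasure P]
      (perm : (n : ℕ) → Ω → Equiv.Perm (Fin (n + 1))), RecSep.IsRecursiveSeparable p P perm →
      ∃ μ : Ω → ProbabilityMeasure (I × I), Measurable μ ∧ (∀ ω, RecSep.IsPermuton (μ ω)) ∧
        (∀ᵐ ω ∂P, Tendsto (fun n => RecSep.permPermuton (perm n ω)) atTop (𝓝 (μ ω))) ∧
        ∀ (Ω' : Type*) [MeasurableSpace Ω'] (P' : Measure Ω') [IsProbabilityMeasure P']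
          (U : ℕ → Ω' → I) (S : ℕ → Ω' → Bool), RecSep.IsUniformSigned p P' U S →
          IdentDistrib μ (fun ω => RecSep.muRec (fun j => U j ω) (fun j => S j ω)) P P') ∧
    (∀ (Ω' : Type*) [MeasurableSpace Ω'] (P' : Measure Ω') [IsProbabilityMeasure P']
      (U : ℕ → Ω' → I) (S : ℕ → Ω' → Bool), RecSep.IsUniformSigned p P' U S →
      (∀ᵐ ω ∂P', IsStrictTotalOrder I (RecSep.prec (fun j => U j ω) (fun j => S j ω)) ∧
        MeasurePreserving (RecSep.phi (fun j => U j ω) (fun j => S j ω)) volume volume ∧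
        RecSep.IsPermuton (RecSep.muRec (fun j => U j ω) (fun j => S j ω))) ∧
      ∃ perm : (n : ℕ) → Ω' → Equiv.Perm (Fin (n + 1)), RecSep.IsRecursiveSeparable p P' perm ∧
        ∀ᵐ ω ∂P', Tendsto (fun n => RecSep.permPermuton (perm n ω)) atTop
          (𝓝 (RecSep.muRec (fun j => U j ω) (fun j => S j ω)))) := by
  refine ⟨fun Ω _ P _ perm h => ?_, fun Ω' _ P' _ U S h => ⟨?_, ?_⟩⟩
  · exact ⟨fun ω => RecSep.limitPermuton fun n => perm n ω,
      RecSep.measurable_limitPermuton.comp h.measurable_path,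
      fun ω => RecSep.isPermuton_limitPermuton _, h.ae_tendsto (Set.Ioo_subset_Icc_self hp),
      fun Ω' _ P' _ U S hUS => h.identDistrib hUS⟩
  · filter_upwards [h.ae_equidistributed] with ω hω using
      ⟨hω.isStrictTotalOrder_prec _, hω.measurePreserving_phi _, hω.isPermuton_muRec _⟩
  · exact ⟨_, h.isRecursiveSeparable, h.ae_tendsto_gapPerm⟩
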